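/- Let $n\ge 2$, let $a>b\ge 0$ be integers, and let $f(\mathbf z)\in\mathbb C[z_1,\dots,z_n]$ be a homogeneous polynomial of degree $d>0$ that is convenient (for each $j$ it contains a monomial $z_j^{e}$, $e>0$, with non-zero coefficient) and non-degenerate (for every weight vector $P$ of positive integers, the part $f_P$ of $f$ of least $P$-degree has no critical point on $f_P^{-1}(0)\cap(\mathbb C^*)^n$). Put $$g(\mathbf w)=f(w_1^a\bar w_1^b,\dots,w_n^a\bar w_n^b).$$ For $r>0$ let $S_r=\{\mathbf z\in\mathbb C^n : \sum_j |z_j|^2=r^2\}$, oriented as the boundary of the ball, let $K_r=g^{-1}(0)\cap S_r$, and let $\theta=g/|g|:S_r\setminus K_r\to S^1$ (also written as an angle, $g=|g|e^{i\theta}$). Let $\alpha=2\sum_j(x_j\,dy_j-y_j\,dx_j)$ be the canonical $1$-form, where $z_j=x_j+iy_j$, and let $\omega=d\alpha$. Theorem. For every $r>0$: (a) $(K_r,\theta)$ is an open book on $S_r$: $K_r\subset S_r$ is a smooth submanifold of codimension two, $\theta$ is a locally trivial smooth fibration, and for some $\delta>0$ there is a diffeomorphism from $K_r\times D_\delta$,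 where $D_\delta=\{\eta\in\mathbb C:|\eta|<\delta\}$, onto an open neighbourhood of $K_r$ in $S_r$, equal to the identity on $K_r\times\{0\}$, under which $\theta$ becomes $(x,\eta)\mapsto\eta/|\eta|$. (b) $\alpha|_{S_r}$ is a positive contact form, i.e. $\alpha\wedge(d\alpha)^{n-1}>0$ on $S_r$, and $\alpha$ and $\omega$ are adapted to this open book: $\alpha|_{K_r}$ is a contact form on $K_r$, i.e. $\alpha\wedge(d\alpha)^{n-2}$ vanishes nowhere on $K_r$; on each fibre $F_\eta=\theta^{-1}(\eta)$ the form $\omega$ is symplectic and $\omega^{n-1}$ is positive for the orientation of $F_\eta$ induced by $S_r$ and $\theta$; and the orientation of $K_r$ defined by $\alpha\wedge(d\alpha)^{n-2}$ is its orientation as the boundary of the oriented fibres $F_\eta$. (c) There is a unique Reeb vector field $R$ of $\alpha$ on $S_r$ (the tangent vector field with $\alpha(R)=1$ and $\omega(R,v)=0$ for all $v$ tangent to $S_r$), and on $S_r\setminus K_r$ $$d\theta(R)=\frac{d\,(a-b)}{2r^2}>0,$$ where the $d$ on the right is the degree of $f$. -/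

import Mathlib

open scoped ContDiff ComplexConjugate

noncomputable section

namespace MixedLink

/-! ### Smooth maps and submanifolds of normed spaces -/

section Smooth

variable {V W : Type*} [NormedAddCommGroup V] [NormedSpace ℝ V]
  [NormedAddCommGroup W] [NormedSpace ℝ W]

/-- `F` is smooth on the (arbitrary) subset `X`: near each point of `X` it is the restriction of a
smooth map defined on an open subset of the ambient space. -/
def SmoothOnSet (F : V → W) (X : Set V) : Prop :=
  ∀ x ∈ X, ∃ U : Set V, IsOpen U ∧ x ∈ U ∧
    ∃ G : V → W, ContDiffOn ℝ ∞ G U ∧ Set.EqOn F G (X ∩ U)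

/-- `F` restricts to a diffeomorphism from the subset `X` onto the subset `Y`. -/
def DiffeoOn (F : V → W) (X : Set V) (Y : Set W) : Prop :=
  ∃ G : W → V, SmoothOnSet F X ∧ SmoothOnSet G Y ∧ Set.MapsTo F X Y ∧ Set.MapsTo G Y X ∧
    Set.LeftInvOn G F X ∧ Set.RightInvOn G F Y

/-- `X` is a smooth (embedded) submanifold of codimension `c` of `V`. -/
def IsSubmanifold (c : ℕ) (X : Set V) : Prop :=
  ∀ x ∈ X, ∃ U : Set V, IsOpen U ∧ x ∈ U ∧
    ∃ h : V → EuclideanSpace ℝ (Fin c), ContDiffOn ℝ ∞ h U ∧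
      X ∩ U = {y ∈ U | h y = 0} ∧
      ∀ y ∈ X ∩ U, Function.Surjective (fderiv ℝ h y)

/-- The tangent space of `X` at `x`: the velocities at time `0` of smooth curves in `X`
through `x`. -/
def tangentVectors (X : Set V) (x : V) : Set V :=
  {v | ∃ γ : ℝ → V, ∃ ε > 0, ContDiffOn ℝ ∞ γ (Set.Ioo (-ε) ε) ∧
    (∀ t ∈ Set.Ioo (-ε) ε, γ t ∈ X) ∧ γ 0 = x ∧ deriv γ 0 = v}

/-- `v` consists of `k` linearly independent tangent vectors of `X` at `x`. It is used with
`k = dim X`, so that `v` is a basis of the tangent space. -/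
def IsFrame (X : Set V) (x : V) {k : ℕ} (v : Fin k → V) : Prop :=
  (∀ i, v i ∈ tangentVectors X x) ∧ LinearIndependent ℝ v

/-! ### Exterior powers of `1`- and `2`-forms, contact and symplectic forms -/

/-- The value of `Ω ∧ ⋯ ∧ Ω` (`k` factors) for an alternating `2`-form `Ω`. -/
def twoFormPow (Ω : V [⋀^Fin 2]→L[ℝ] ℝ) (k : ℕ) (v : Fin (2 * k) → V) : ℝ :=
  (1 / 2 ^ k) * ∑ σ : Equiv.Perm (Fin (2 * k)), ((Equiv.Perm.sign σ : ℤ) : ℝ) *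
    ∏ i : Fin k, Ω ![v (σ ⟨2 * i, by omega⟩), v (σ ⟨2 * i + 1, by omega⟩)]

/-- The value of `β ∧ Ω ∧ ⋯ ∧ Ω` (`k` factors `Ω`) for a `1`-form `β` and a `2`-form `Ω`. -/
def oneFormWedgePow (β : V [⋀^Fin 1]→L[ℝ] ℝ) (Ω : V [⋀^Fin 2]→L[ℝ] ℝ) (k : ℕ)
    (v : Fin (2 * k + 1) → V) : ℝ :=
  (1 / 2 ^ k) * ∑ σ : Equiv.Perm (Fin (2 * k + 1)), ((Equiv.Perm.sign σ : ℤ) : ℝ) *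
    (β ![v (σ 0)] *
      ∏ i : Fin k, Ω ![v (σ ⟨2 * i + 1, by omega⟩), v (σ ⟨2 * i + 2, by omega⟩)])

/-- `α ∧ (dα)^k` at the point `x`. -/
def contactVolume (α : V → V [⋀^Fin 1]→L[ℝ] ℝ) (k : ℕ) (x : V) (v : Fin (2 * k + 1) → V) : ℝ :=
  oneFormWedgePow (α x) (extDeriv α x) k v

/-- The restriction of the `1`-form `α` to the `(2k+1)`-dimensional submanifold `X` is a contact
form: `α ∧ (dα)^k` vanishes at no point of `X`. -/
def IsContactFormOn (α : V → V [⋀^Fin 1]→L[ℝ] ℝ) (k : ℕ) (X : Set V) : Prop :=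
  ∀ x ∈ X, ∀ v : Fin (2 * k + 1) → V, IsFrame X x v → contactVolume α k x v ≠ 0

/-- The restriction of the `2`-form `Ω` to the submanifold `X` is closed and non-degenerate. -/
def IsSymplecticOn (Ω : V → V [⋀^Fin 2]→L[ℝ] ℝ) (X : Set V) : Prop :=
  ∀ x ∈ X,
    (∀ v : Fin 3 → V, (∀ i, v i ∈ tangentVectors X x) → extDeriv Ω x v = 0) ∧
    (∀ u ∈ tangentVectors X x, (∀ v ∈ tangentVectors X x, Ω x ![u, v] = 0) → u = 0)

/-- `R` is the value at `x` of the Reeb vector field of the contact form `α` on `M`. -/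
def IsReebVector (α : V → V [⋀^Fin 1]→L[ℝ] ℝ) (M : Set V) (x R : V) : Prop :=
  R ∈ tangentVectors M x ∧ α x ![R] = 1 ∧
    ∀ v ∈ tangentVectors M x, extDeriv α x ![R, v] = 0

/-! ### Open books

The map `θ` to the circle takes values in the unit circle of `ℂ`. -/

/-- The page `θ⁻¹(η)` of `θ : M \ N → S¹`. -/
def page (M N : Set V) (θ : V → ℂ) (η : ℂ) : Set V :=
  {z ∈ M \ N | θ z = η}

/-- The differential of the angle: the value on `u` of the `1`-form `dθ` (that is, of
`-i θ⁻¹ dθ` for `θ` viewed as a unit complex number). -/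
def dAngle (θ : V → ℂ) (z u : V) : ℝ :=
  (conj (θ z) * fderiv ℝ θ z u).im

/-- `Φ` is a trivial tubular neighbourhood `N × D_δ ≅ M ∩ O` of `N` in `M` on which `θ` is the
angular coordinate of the disc `D_δ`. -/
structure IsTubularNbhd (M N : Set V) (θ : V → ℂ) (δ : ℝ) (Φ : V × ℂ → V) : Prop where
  pos : 0 < δ
  diffeo : ∃ O : Set V, IsOpen O ∧ N ⊆ O ∧ DiffeoOn Φ (N ×ˢ Metric.ball (0 : ℂ) δ) (M ∩ O)
  core : ∀ x ∈ N, Φ (x, 0) = x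
  angle : ∀ x ∈ N, ∀ η ∈ Metric.ball (0 : ℂ) δ, η ≠ 0 → θ (Φ (x, η)) = η / (‖η‖ : ℂ)

/-- `(N, θ)` is an open book with binding `N` on the submanifold `M` (of codimension `c` in `V`):
`N` is a submanifold of `M` of codimension two with a trivial tubular neighbourhood in which `θ` is
the angular coordinate, and `θ : M \ N → S¹` is a locally trivial smooth fibration. -/
structure IsOpenBook (c : ℕ) (M N : Set V) (θ : V → ℂ) : Prop where
  manifold : IsSubmanifold c M
  binding_subset : N ⊆ M
  binding : IsSubmanifold (c + 2) N
  smooth : ∃ O : Set V, IsOpen O ∧ M \ N ⊆ O ∧ ContDiffOn ℝ ∞ θ O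
  norm_eq_one : ∀ z ∈ M \ N, ‖θ z‖ = 1
  locally_trivial : ∀ η ∈ Metric.sphere (0 : ℂ) 1, ∃ A : Set ℂ, IsOpen A ∧ η ∈ A ∧
    ∃ H : V × ℂ → V,
      DiffeoOn H (page M N θ η ×ˢ (A ∩ Metric.sphere (0 : ℂ) 1)) {z ∈ M \ N | θ z ∈ A} ∧
      ∀ p ∈ page M N θ η, ∀ ζ ∈ A ∩ Metric.sphere (0 : ℂ) 1, θ (H (p, ζ)) = ζ
  tubular : ∃ (δ : ℝ) (Φ : V × ℂ → V), IsTubularNbhd M N θ δ Φ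

/-- The contact form `α` on the oriented manifold `M` of dimension `2k+3` is positive and is
carried by (adapted to) the open book `(N, θ)`. The orientation of `M` is given by the volume form
`vol`.

The page `θ⁻¹(η)` carries its canonical orientation: `v` is a positive basis if and only if `(u, v)`
is a positive basis of the tangent space of `M` whenever `dθ(u) > 0`. The binding is oriented as the
boundary of the closed page, outward normal first. At `x ∈ N`, in a tubular neighbourhood `Φ`,
the inward normal of the closed page is the derivative of `t ↦ Φ (x, t η)` at `0`, and the derivative
of `t ↦ Φ (x, t i η)` at `0` points to the positive side of the page. -/
structure IsCarriedBy (k : ℕ) (M : Set V) (vol : V → (Fin (2 * k + 3) → V) → ℝ) (N : Set V)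
    (θ : V → ℂ) (α : V → V [⋀^Fin 1]→L[ℝ] ℝ) : Prop where
  contact : IsContactFormOn α (k + 1) M
  positive : ∀ z ∈ M, ∀ v : Fin (2 * k + 3) → V, IsFrame M z v →
    (0 < contactVolume α (k + 1) z v ↔ 0 < vol z v)
  contact_binding : IsContactFormOn α k N
  symplectic_page : ∀ η ∈ Metric.sphere (0 : ℂ) 1, IsSymplecticOn (extDeriv α) (page M N θ η)
  positive_page : ∀ η ∈ Metric.sphere (0 : ℂ) 1, ∀ z ∈ page M N θ η,
    ∀ u ∈ tangentVectors M z, 0 < dAngle θ z u →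
    ∀ v : Fin (2 * k + 2) → V, IsFrame (page M N θ η) z v →
      (0 < twoFormPow (extDeriv α z) (k + 1) v ↔ 0 < vol z (Fin.cons u v))
  orientation_binding : ∀ (δ : ℝ) (Φ : V × ℂ → V), IsTubularNbhd M N θ δ Φ →
    ∀ η ∈ Metric.sphere (0 : ℂ) 1, ∀ x ∈ N, ∀ w : Fin (2 * k + 1) → V, IsFrame N x w →
      (0 < contactVolume α k x w ↔
        0 < vol x (Fin.cons (deriv (fun t : ℝ => Φ (x, (t : ℂ) * (Complex.I * η))) 0)
          (Fin.cons (-deriv (fun t : ℝ => Φ (x, (t : ℂ) * η)) 0) w)))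

end Smooth

/-! ### The spheres of `ℂⁿ` and their canonical contact form -/

/-- `ℂⁿ` with its Euclidean norm. -/
abbrev Cn (n : ℕ) := EuclideanSpace ℂ (Fin n)

/-- The canonical `1`-form `α = -dρ ∘ J = 2 ∑ (x_j dy_j - y_j dx_j)` on `ℂⁿ`, `ρ = ∑ |z_j|²`. -/
def canonicalForm (n : ℕ) (z : Cn n) : Cn n [⋀^Fin 1]→L[ℝ] ℝ :=
  ContinuousAlternatingMap.ofSubsingleton ℝ (Cn n) ℝ (0 : Fin 1)
    (∑ j : Fin n,
      ((2 * (z j).re) • (Complex.imCLM ∘L (EuclideanSpace.proj j : Cn n →L[ℂ] ℂ).restrictScalars ℝ)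
      - (2 * (z j).im) •
        (Complex.reCLM ∘L (EuclideanSpace.proj j : Cn n →L[ℂ] ℂ).restrictScalars ℝ)))

/-- The real coordinates `(x_1, y_1, …, x_n, y_n)` of a vector of `ℂⁿ`. -/
def realCoord {n : ℕ} (v : Cn n) (c : Fin (2 * n)) : ℝ :=
  if (c : ℕ) % 2 = 0 then (v ⟨c / 2, by omega⟩).re else (v ⟨c / 2, by omega⟩).im

/-- The standard volume form `dx_1 ∧ dy_1 ∧ ⋯ ∧ dx_n ∧ dy_n` of `ℂⁿ`. -/
def standardVolume {n : ℕ} (v : Fin (2 * n) → Cn n) : ℝ :=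
  (Matrix.of fun i c => realCoord (v i) c).det

/-- The orientation of the spheres `S_r ⊆ ℂ^{k+2}` centred at the origin as boundaries of balls:
`v` is positive if `(z, v)` is a positive basis of `ℂ^{k+2}`. -/
def sphereVolume (k : ℕ) (z : Cn (k + 2)) (v : Fin (2 * k + 3) → Cn (k + 2)) : ℝ :=
  standardVolume (n := k + 2) (Fin.cons z v : Fin (2 * k + 4) → Cn (k + 2))

/-! ### Polynomials and mixed coverings -/

/-- `f` is convenient: it contains a power of each variable with a non-zero coefficient. -/
def IsConvenient {n : ℕ} (f : MvPolynomial (Fin n) ℂ) : Prop :=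
  ∀ j, ∃ e : ℕ, 0 < e ∧ f.coeff (Finsupp.single j e) ≠ 0

/-- `f` is (Newton) non-degenerate: for each strictly positive weight vector `P`, the face function
`f_P` (the part of `f` of least `P`-degree) has no critical point on `f_P⁻¹(0) ∩ (ℂ*)ⁿ`. -/
def IsNonDegenerate {n : ℕ} (f : MvPolynomial (Fin n) ℂ) : Prop :=
  ∀ P : Fin n → ℕ, (∀ j, 0 < P j) →
    ∀ e : ℕ, IsLeast {e' | ∃ ν ∈ f.support, Finsupp.weight P ν = e'} e →
      ∀ z : Fin n → ℂ, (∀ j, z j ≠ 0) →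
        MvPolynomial.eval z (MvPolynomial.weightedHomogeneousComponent P e f) = 0 →
        ∃ j, MvPolynomial.eval z
          (MvPolynomial.pderiv j (MvPolynomial.weightedHomogeneousComponent P e f)) ≠ 0

/-- The mixed function `g(w) = f(w_1^a \bar w_1^b, …, w_n^a \bar w_n^b)`, the pull-back of `f` under
the homogeneous mixed covering `φ_{a,b}`. -/
def mixedPullback {n : ℕ} (a b : ℕ) (f : MvPolynomial (Fin n) ℂ) (w : Cn n) : ℂ :=
  MvPolynomial.eval (fun j => w j ^ a * conj (w j) ^ b) f

/-- The link `K_r = g⁻¹(0) ∩ S_r`. -/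
def link {n : ℕ} (g : Cn n → ℂ) (r : ℝ) : Set (Cn n) :=
  {z ∈ Metric.sphere (0 : Cn n) r | g z = 0}

/-- The Milnor map `g / |g|`. -/
def milnorMap {n : ℕ} (g : Cn n → ℂ) (z : Cn n) : ℂ :=
  g z / (‖g z‖ : ℂ)

end MixedLink

end

/-! The forms are read off the Hermitian product: `α_z(u) = 2 Im ⟨z,u⟩` and `ω(u,w) = 4 Im ⟨u,w⟩`.
Hence `ι_z ω = 2 α_z`, so `α ∧ ω^(n-1)` is a positive multiple of the contraction of the standard
volume with `z`. On the tangent space of `S_r` the kernel of `ω` is spanned by `iz`, and the Reeb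
field is `iz / (2 r²)`.

Two properties of `g` carry the rest. The first is homogeneity (`IsPolarHomogeneous`): multiplying
`z` by `e^{it}` multiplies `g` by `e^{iNt}` with `N = d(a-b) > 0`, and positive dilations multiply
`g` by positive numbers. So `θ` turns at speed `N` along the circle action. This gives the local
trivialisations and `dθ(iz) = N`; the Reeb field is therefore positively transverse to the pages,
which makes them symplectic with the right orientation.

The second concerns `dg` on the link. Write `dg(v) = ∑ (A_j v_j + B_j conj v_j)`. Then `|A_j|² -
|B_j|² = (a²-b²) |∂_j f|² |w_j|^(2(a+b-1)) ≥ 0`, and convenience with non-degeneracy makes one term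
positive (`exists_pderiv_ne_zero`). The sum is a positive multiple of `ω(ξ₁,ξ₂)`, where `ξ₁, ξ₂` are
the `ω`-duals of `Re dg` and `Im dg` (`IsSymplecticPair`). Thus `dg` is onto with symplectic kernel.
By Euler's identity `z` lies in that kernel, and contracting with it shows that `α` is contact on
`K_r`.

The tubular neighbourhood comes from `(|z|²-r², Re g, Im g)`, which is a submersion along `K_r`; on
the sphere `g` itself becomes the disc coordinate. For the boundary orientation, in any tubular
neighbourhood `dg` maps the derivative in the direction `η` to a positive multiple of `η`, and all
volumes are compared with `vol(ξ₁, ξ₂, x, w)`. -/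

open scoped ContDiff ComplexConjugate

noncomputable section

namespace MixedLink

/-! ### Pfaffian sums -/

section Pfaffian

variable {V : Type*}

/-- The summand of `twoFormPow` indexed by the permutation `σ`. -/
def pairingTerm (B : V → V → ℝ) (n : ℕ) (v : Fin (2 * n) → V) (σ : Equiv.Perm (Fin (2 * n))) : ℝ :=
  ((Equiv.Perm.sign σ : ℤ) : ℝ) *
    ∏ i : Fin n, B (v (σ ⟨2 * i, by omega⟩)) (v (σ ⟨2 * i + 1, by omega⟩))

/-- The bijection `(i, s) ↦ 2 i + s`. -/
def pairEquiv (n : ℕ) : Fin n × Fin 2 ≃ Fin (2 * n) :=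
  finProdFinEquiv.trans (finCongr (Nat.mul_comm n 2))

lemma pairEquiv_val {n : ℕ} (i : Fin n) (s : Fin 2) : (pairEquiv n (i, s) : ℕ) = s + 2 * i := by
  simp [pairEquiv]

lemma pairEquiv_zero {n : ℕ} (i : Fin n) : pairEquiv n (i, 0) = ⟨2 * i, by omega⟩ := by
  ext; simp [pairEquiv_val]

lemma pairEquiv_one {n : ℕ} (i : Fin n) : pairEquiv n (i, 1) = ⟨2 * i + 1, by omega⟩ := by
  ext; simp [pairEquiv_val, add_comm]

lemma pairingTerm_eq (B : V → V → ℝ) (n : ℕ) (v : Fin (2 * n) → V)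
    (σ : Equiv.Perm (Fin (2 * n))) :
    pairingTerm B n v σ = ((Equiv.Perm.sign σ : ℤ) : ℝ) *
      ∏ i : Fin n, B (v (σ (pairEquiv n (i, 0)))) (v (σ (pairEquiv n (i, 1)))) := by
  simp only [pairingTerm, pairEquiv_zero, pairEquiv_one]

lemma perm_fin_two (h : Equiv.Perm (Fin 2)) : h = 1 ∨ h = Equiv.swap 0 1 := by
  revert h; decide

/-- Flipping some of the pairs does not change the summand. -/
lemma pairingTerm_mul_flip {B : V → V → ℝ} (hB : ∀ u w, B u w = -B w u) (n : ℕ)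
    (v : Fin (2 * n) → V) (σ : Equiv.Perm (Fin (2 * n))) (h : Fin n → Equiv.Perm (Fin 2)) :
    pairingTerm B n v (σ * (pairEquiv n).permCongr (Equiv.prodCongrRight h)) =
      pairingTerm B n v σ := by
  rw [pairingTerm_eq, pairingTerm_eq, Equiv.Perm.sign_mul, Equiv.Perm.sign_permCongr,
    Equiv.Perm.sign_prodCongrRight]
  have key : ∀ i : Fin n,
      B (v ((σ * (pairEquiv n).permCongr (Equiv.prodCongrRight h)) (pairEquiv n (i, 0))))
        (v ((σ * (pairEquiv n).permCongr (Equiv.prodCongrRight h)) (pairEquiv n (i, 1)))) =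
      ((Equiv.Perm.sign (h i) : ℤ) : ℝ) *
        B (v (σ (pairEquiv n (i, 0)))) (v (σ (pairEquiv n (i, 1)))) := by
    intro i
    rcases perm_fin_two (h i) with hi | hi
    · simp [Equiv.Perm.mul_apply, Equiv.permCongr_apply, Equiv.prodCongrRight_apply, hi]
    · simp only [Equiv.Perm.mul_apply, Equiv.permCongr_apply, Equiv.symm_apply_apply,
        Equiv.prodCongrRight_apply, hi, Equiv.swap_apply_left, Equiv.swap_apply_right,
        Equiv.Perm.sign_swap (zero_ne_one : (0 : Fin 2) ≠ 1)]
      rw [hB]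
      simp
  rw [Finset.prod_congr rfl fun i _ => key i, Finset.prod_mul_distrib]
  have hs : (((∏ i, Equiv.Perm.sign (h i) : ℤˣ) : ℤ) : ℝ) *
      (((∏ i, Equiv.Perm.sign (h i) : ℤˣ) : ℤ) : ℝ) = 1 := by
    rw [← Int.cast_mul, ← Units.val_mul, Int.units_mul_self]; simp
  push_cast at hs ⊢
  linear_combination (((Equiv.Perm.sign σ : ℤ) : ℝ) *
    ∏ i, B (v (σ (pairEquiv n (i, 0)))) (v (σ (pairEquiv n (i, 1))))) * hs

/-- Permuting the pairs does not change the summand. -/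
lemma pairingTerm_mul_permPairs (B : V → V → ℝ) (n : ℕ)
    (v : Fin (2 * n) → V) (σ : Equiv.Perm (Fin (2 * n))) (p : Equiv.Perm (Fin n)) :
    pairingTerm B n v (σ * (pairEquiv n).permCongr (Equiv.prodCongrLeft fun _ : Fin 2 => p)) =
      pairingTerm B n v σ := by
  rw [pairingTerm_eq, pairingTerm_eq, Equiv.Perm.sign_mul, Equiv.Perm.sign_permCongr,
    Equiv.Perm.sign_prodCongrLeft, Fin.prod_univ_two, Int.units_mul_self, mul_one]
  congr 1
  simp only [Equiv.Perm.mul_apply, Equiv.permCongr_apply, Equiv.symm_apply_apply,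
    Equiv.prodCongrLeft_apply]
  exact Equiv.prod_comp p
    (fun i => B (v (σ (pairEquiv n (i, 0)))) (v (σ (pairEquiv n (i, 1)))))

/-- A permutation that preserves the pairs is composed of a permutation of the pairs and flips. -/
lemma exists_pair_decomposition {n : ℕ} (σ : Equiv.Perm (Fin (2 * n)))
    (hσ : ∀ i, ((pairEquiv n).symm (σ (pairEquiv n (i, 0)))).1 =
      ((pairEquiv n).symm (σ (pairEquiv n (i, 1)))).1) :
    ∃ (p : Equiv.Perm (Fin n)) (h : Fin n → Equiv.Perm (Fin 2)),
      σ = (pairEquiv n).permCongr (Equiv.prodCongrLeft fun _ : Fin 2 => p) *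
        (pairEquiv n).permCongr (Equiv.prodCongrRight h) := by
  set τ : Fin n × Fin 2 → Fin n × Fin 2 := fun x => (pairEquiv n).symm (σ (pairEquiv n x)) with hτ
  have τinj : Function.Injective τ :=
    (pairEquiv n).symm.injective.comp (σ.injective.comp (pairEquiv n).injective)
  have τsurj : Function.Surjective τ :=
    (pairEquiv n).symm.surjective.comp (σ.surjective.comp (pairEquiv n).surjective)
  have hfst : ∀ i s, (τ (i, s)).1 = (τ (i, 0)).1 := by
    intro i s
    fin_cases s
    · rfl
    · exact (hσ i).symm
  have psurj : Function.Surjective fun i => (τ (i, 0)).1 := by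
    intro j
    obtain ⟨⟨i, s⟩, hi⟩ := τsurj (j, 0)
    exact ⟨i, by simp only [← hfst i s, hi]⟩
  have hinj : ∀ i, Function.Injective fun s => (τ (i, s)).2 := by
    intro i s t hst
    have : τ (i, s) = τ (i, t) := Prod.ext ((hfst i s).trans (hfst i t).symm) hst
    exact congrArg Prod.snd (τinj this)
  have pbij : Function.Bijective fun i => (τ (i, 0)).1 :=
    ⟨Finite.injective_iff_surjective.2 psurj, psurj⟩
  have hbij : ∀ i, Function.Bijective fun s => (τ (i, s)).2 :=
    fun i => ⟨hinj i, Finite.injective_iff_surjective.1 (hinj i)⟩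
  -- The first component of `τ (i, s)` does not depend on `s`, so it permutes the pairs; the second
  -- component is the flip inside the pair `i`.
  refine ⟨Equiv.ofBijective _ pbij, fun i => Equiv.ofBijective _ (hbij i), ?_⟩
  ext x : 1
  obtain ⟨⟨i, s⟩, rfl⟩ := (pairEquiv n).surjective x
  simp only [Equiv.Perm.mul_apply, Equiv.permCongr_apply, Equiv.symm_apply_apply,
    Equiv.prodCongrLeft_apply, Equiv.prodCongrRight_apply, Equiv.ofBijective_apply]
  rw [← hfst i s]
  simp [hτ]

/-- No cancellation occurs: a permutation that breaks some pair has a zero factor, and one that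
preserves the pairs contributes the same positive number as the identity. -/
lemma sum_pairingTerm_pos {B : V → V → ℝ} (hB : ∀ u w, B u w = -B w u) (n : ℕ)
    (v : Fin (2 * n) → V)
    (hpos : ∀ i, 0 < B (v (pairEquiv n (i, 0))) (v (pairEquiv n (i, 1))))
    (horth : ∀ i j s t, i ≠ j → B (v (pairEquiv n (i, s))) (v (pairEquiv n (j, t))) = 0) :
    0 < ∑ σ, pairingTerm B n v σ := by
  have h1 : 0 < pairingTerm B n v 1 := by
    rw [pairingTerm_eq]
    simpa using Finset.prod_pos fun i _ => hpos i
  refine Finset.sum_pos' (fun σ _ => ?_) ⟨1, Finset.mem_univ _, h1⟩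
  by_cases hσ : ∀ i, ((pairEquiv n).symm (σ (pairEquiv n (i, 0)))).1 =
      ((pairEquiv n).symm (σ (pairEquiv n (i, 1)))).1
  · obtain ⟨p, h, rfl⟩ := exists_pair_decomposition σ hσ
    rw [pairingTerm_mul_flip hB]
    have := pairingTerm_mul_permPairs B n v 1 p
    rw [one_mul] at this
    exact this ▸ h1.le
  · push Not at hσ
    obtain ⟨i, hi⟩ := hσ
    rw [pairingTerm_eq, Finset.prod_eq_zero (Finset.mem_univ i), mul_zero]
    have := horth _ _ ((pairEquiv n).symm (σ (pairEquiv n (i, 0)))).2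
      ((pairEquiv n).symm (σ (pairEquiv n (i, 1)))).2 hi
    simpa using this

/-- The first vector contributes equally from each slot, because a pair exchange followed by flips,
both leaving the summand unchanged, moves slot `0` to slot `j`. -/
lemma sum_pairingTerm_ite {B : V → V → ℝ} (hB : ∀ u w, B u w = -B w u) (m : ℕ)
    (v : Fin (2 * (m + 1)) → V) (j : Fin (2 * (m + 1))) :
    (∑ σ : Equiv.Perm (Fin (2 * (m + 1))), if σ j = 0 then pairingTerm B (m + 1) v σ else 0) =
      ∑ σ : Equiv.Perm (Fin (2 * (m + 1))), if σ 0 = 0 then pairingTerm B (m + 1) v σ else 0 := by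
  obtain ⟨⟨i, s⟩, rfl⟩ := (pairEquiv (m + 1)).surjective j
  set τ : Equiv.Perm (Fin (2 * (m + 1))) :=
    (pairEquiv (m + 1)).permCongr (Equiv.prodCongrLeft fun _ : Fin 2 => Equiv.swap 0 i) *
      (pairEquiv (m + 1)).permCongr (Equiv.prodCongrRight fun _ => Equiv.swap 0 s)
  have h0 : (0 : Fin (2 * (m + 1))) = pairEquiv (m + 1) (0, 0) := by
    ext; simp [pairEquiv_val]
  have hτ : τ 0 = pairEquiv (m + 1) (i, s) := by
    rw [h0]
    simp [τ, Equiv.Perm.mul_apply, Equiv.permCongr_apply, Equiv.prodCongrLeft_apply,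
      Equiv.prodCongrRight_apply]
  rw [← Equiv.sum_comp (Equiv.mulRight τ)
    (fun σ => if σ 0 = 0 then pairingTerm B (m + 1) v σ else 0)]
  refine Finset.sum_congr rfl fun σ _ => ?_
  have : pairingTerm B (m + 1) v (σ * τ) = pairingTerm B (m + 1) v σ := by
    simp only [τ, ← mul_assoc]
    rw [pairingTerm_mul_flip hB, pairingTerm_mul_permPairs]
  simp [Equiv.coe_mulRight, Equiv.Perm.mul_apply, hτ, this]

end Pfaffian

/-! ### Contracting powers of a 2-form with a vector. -/

section Contraction

variable {V : Type*} [NormedAddCommGroup V] [NormedSpace ℝ V]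

lemma twoForm_swap (Ω : V [⋀^Fin 2]→L[ℝ] ℝ) (u w : V) : Ω ![u, w] = -Ω ![w, u] := by
  have := Ω.toAlternatingMap.map_swap ![w, u] (i := 0) (j := 1) (by decide)
  have h2 : (![w, u] ∘ Equiv.swap (0 : Fin 2) 1) = ![u, w] := by
    ext i; fin_cases i <;> simp
  rw [h2] at this
  exact this

lemma twoFormPow_eq (Ω : V [⋀^Fin 2]→L[ℝ] ℝ) (k : ℕ) (v : Fin (2 * k) → V) :
    twoFormPow Ω k v = (1 / 2 ^ k) * ∑ σ, pairingTerm (fun u w => Ω ![u, w]) k v σ := rfl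

/-- `ι_z (Ω^{m+1}) = (m + 1) (ι_z Ω) ∧ Ω^m`. -/
lemma twoFormPow_cons (Ω : V [⋀^Fin 2]→L[ℝ] ℝ) (β : V [⋀^Fin 1]→L[ℝ] ℝ) (m : ℕ) (z : V)
    (hβ : ∀ u, β ![u] = Ω ![z, u]) (v : Fin (2 * m + 1) → V) :
    twoFormPow Ω (m + 1) (Fin.cons z v : Fin (2 * m + 2) → V) =
      (m + 1) * oneFormWedgePow β Ω m v := by
  set V' : Fin (2 * (m + 1)) → V := (Fin.cons z v : Fin (2 * m + 2) → V)
  set B : V → V → ℝ := fun u w => Ω ![u, w]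
  have hB : ∀ u w, B u w = -B w u := twoForm_swap Ω
  -- Sort the permutations by the slot occupied by `z`. The `2 (m + 1)` classes have equal sums; the
  -- factor `2` cancels against the normalisation `1 / 2 ^ (m + 1)`.
  have hsum : ∑ σ, pairingTerm B (m + 1) V' σ = (2 * (m + 1) : ℝ) *
      ∑ σ : Equiv.Perm (Fin (2 * (m + 1))), if σ 0 = 0 then pairingTerm B (m + 1) V' σ else 0 := by
    have h1 : ∀ σ : Equiv.Perm (Fin (2 * (m + 1))), pairingTerm B (m + 1) V' σ =
        ∑ j, if σ j = 0 then pairingTerm B (m + 1) V' σ else 0 := by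
      intro σ
      rw [← Equiv.sum_comp σ⁻¹]
      simp
    rw [Finset.sum_congr rfl fun σ _ => h1 σ, Finset.sum_comm,
      Finset.sum_congr rfl fun j _ => sum_pairingTerm_ite hB m V' j]
    simp
  have hdec : (∑ σ : Equiv.Perm (Fin (2 * m + 1 + 1)),
      if σ 0 = 0 then pairingTerm B (m + 1) V' σ else 0) =
      ∑ σ : Equiv.Perm (Fin (2 * m + 1)), ((Equiv.Perm.sign σ : ℤ) : ℝ) *
    (β ![v (σ 0)] *
      ∏ i : Fin m, Ω ![v (σ ⟨2 * i + 1, by omega⟩), v (σ ⟨2 * i + 2, by omega⟩)]) := by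
    -- `decomposeFin` splits a permutation into the image of `0` and a permutation of the other
    -- indices; only image `0` survives the condition.
    rw [← Equiv.sum_comp Equiv.Perm.decomposeFin.symm, Fintype.sum_prod_type]
    rw [Finset.sum_eq_single 0]
    · refine Finset.sum_congr rfl fun σ _ => ?_
      rw [if_pos (by simp)]
      unfold pairingTerm
      have hs : Equiv.Perm.sign (Equiv.Perm.decomposeFin.symm ((0 : Fin (2 * m + 1 + 1)), σ)) =
          Equiv.Perm.sign σ := by simp
      refine congrArg₂ (· * ·) (congrArg (fun u : ℤˣ => ((u : ℤ) : ℝ)) hs) ?_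
      have hval : ∀ x : Fin (2 * m + 1),
          V' (Equiv.Perm.decomposeFin.symm ((0 : Fin (2 * m + 1 + 1)), σ) x.succ) = v (σ x) := by
        intro x
        simp [V']
      have hval0 : V' (Equiv.Perm.decomposeFin.symm ((0 : Fin (2 * m + 1 + 1)), σ) 0) = z := by
        simp [V']
      rw [Fin.prod_univ_succ]
      congr 1
      rw [hβ, ← hval0, ← hval 0]
      rfl
    · intro p _ hp
      refine Finset.sum_eq_zero fun σ _ => ?_
      rw [if_neg]
      simpa using hp
    · simp
  rw [twoFormPow_eq, hsum]
  unfold oneFormWedgePow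
  rw [← hdec]
  rw [pow_succ]
  field_simp
  rfl

/-- A term in which `u` enters a factor `Ω` pairs it with some `v i` and vanishes, so `u` must be
the argument of `β`. -/
lemma oneFormWedgePow_cons (Ω : V [⋀^Fin 2]→L[ℝ] ℝ) (β : V [⋀^Fin 1]→L[ℝ] ℝ) (m : ℕ) (u : V)
    (v : Fin (2 * m) → V) (hu : ∀ i, Ω ![u, v i] = 0) :
    oneFormWedgePow β Ω m (Fin.cons u v : Fin (2 * m + 1) → V) =
      β ![u] * twoFormPow Ω m v := by
  unfold oneFormWedgePow twoFormPow
  rw [mul_left_comm]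
  congr 1
  rw [← Equiv.sum_comp Equiv.Perm.decomposeFin.symm, Fintype.sum_prod_type,
    Finset.sum_eq_single 0, Finset.mul_sum]
  · refine Finset.sum_congr rfl fun σ _ => ?_
    simp only [Equiv.Perm.decomposeFin.symm_sign, if_true, one_mul,
      Equiv.Perm.decomposeFin_symm_apply_zero, Fin.cons_zero]
    rw [mul_left_comm]
    congr 2
  · intro p _ hp
    refine Finset.sum_eq_zero fun σ _ => ?_
    set τ := Equiv.Perm.decomposeFin.symm (p, σ)
    have hτ0 : τ 0 = p := by simp [τ]
    obtain ⟨x, hx⟩ : ∃ x, τ x = 0 := τ.surjective 0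
    have hx0 : x ≠ 0 := by rintro rfl; exact hp (hτ0.symm.trans hx)
    obtain ⟨y, rfl⟩ := Fin.exists_succ_eq.2 hx0
    have hzero : ∀ w : Fin (2 * m + 1), w ≠ 0 →
        Ω ![u, (Fin.cons u v : Fin (2 * m + 1) → V) w] = 0 := by
      intro w hw
      obtain ⟨w, rfl⟩ := Fin.exists_succ_eq.2 hw
      simpa using hu w
    rw [Finset.prod_eq_zero (Finset.mem_univ (⟨y / 2, by omega⟩ : Fin m)), mul_zero, mul_zero]
    -- The parity of `y` decides whether `u` is the left or the right argument of its factor.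
    rcases Nat.even_or_odd' (y : ℕ) with ⟨c, hc | hc⟩
    · have e1 : (⟨2 * (y / 2 : ℕ) + 1, by omega⟩ : Fin (2 * m + 1)) = y.succ := by
        ext; simp; omega
      simp only [e1, hx, Fin.cons_zero]
      apply hzero
      rw [← hx]
      intro h
      have := congrArg Fin.val (τ.injective h)
      simp at this
      omega
    · have e1 : (⟨2 * (y / 2 : ℕ) + 2, by omega⟩ : Fin (2 * m + 1)) = y.succ := by
        ext; simp; omega
      simp only [e1, hx, Fin.cons_zero]
      rw [twoForm_swap, neg_eq_zero]
      apply hzero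
      rw [← hx]
      intro h
      have := congrArg Fin.val (τ.injective h)
      simp at this
      omega
  · simp

end Contraction

/-! ### The power of a 2-form as an alternating map. -/

section TopDegree

lemma update_pair_one {V : Type*} (u x y : V) : Function.update ![u, y] 1 x = ![u, x] := by
  ext i; fin_cases i <;> simp

variable {V : Type*} [NormedAddCommGroup V] [NormedSpace ℝ V]

lemma twoForm_add_right (Ω : V [⋀^Fin 2]→L[ℝ] ℝ) (u x y : V) :
    Ω ![u, x + y] = Ω ![u, x] + Ω ![u, y] := by
  have := Ω.toAlternatingMap.map_update_add ![u, 0] 1 x y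
  rwa [update_pair_one, update_pair_one, update_pair_one] at this

lemma twoForm_smul_right (Ω : V [⋀^Fin 2]→L[ℝ] ℝ) (u : V) (c : ℝ) (x : V) :
    Ω ![u, c • x] = c * Ω ![u, x] := by
  have := Ω.toAlternatingMap.map_update_smul ![u, 0] 1 c x
  rwa [update_pair_one, update_pair_one] at this

/-- Each argument occurs in exactly one factor. This reduces multilinearity of the product to
linearity of `Ω` in its right slot. -/
lemma exists_pairing_update (Ω : V [⋀^Fin 2]→L[ℝ] ℝ) (n : ℕ) (v : Fin (2 * n) → V)
    (j : Fin (2 * n)) : ∃ (s : ℝ) (u : V), ∀ w : V,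
    ∏ i : Fin n, Ω ![Function.update v j w ⟨2 * i, by omega⟩,
      Function.update v j w ⟨2 * i + 1, by omega⟩] = s * Ω ![u, w] := by
  set i₀ : Fin n := ⟨j / 2, by omega⟩ with hi₀
  have hrest : ∀ w : V, ∏ i ∈ Finset.univ.erase i₀,
      Ω ![Function.update v j w ⟨2 * i, by omega⟩, Function.update v j w ⟨2 * i + 1, by omega⟩] =
      ∏ i ∈ Finset.univ.erase i₀, Ω ![v ⟨2 * i, by omega⟩, v ⟨2 * i + 1, by omega⟩] := by
    intro w
    refine Finset.prod_congr rfl fun i hi => ?_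
    have hne : (i : ℕ) ≠ j / 2 := fun h => (Finset.mem_erase.1 hi).1 (Fin.ext h)
    rw [Function.update_of_ne, Function.update_of_ne] <;>
    · intro h
      have := congrArg Fin.val h
      simp at this
      omega
  rcases Nat.even_or_odd' (j : ℕ) with ⟨c, hc | hc⟩
  · refine ⟨-∏ i ∈ Finset.univ.erase i₀, Ω ![v ⟨2 * i, by omega⟩, v ⟨2 * i + 1, by omega⟩],
      v ⟨2 * i₀ + 1, by omega⟩, fun w => ?_⟩
    rw [← Finset.prod_erase_mul _ _ (Finset.mem_univ i₀), hrest w,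
      show (⟨2 * i₀, by omega⟩ : Fin (2 * n)) = j from Fin.ext (by simp [hi₀]; omega),
      Function.update_self, Function.update_of_ne, twoForm_swap]
    · ring
    · intro h
      have := congrArg Fin.val h
      simp [hi₀] at this
      omega
  · refine ⟨∏ i ∈ Finset.univ.erase i₀, Ω ![v ⟨2 * i, by omega⟩, v ⟨2 * i + 1, by omega⟩],
      v ⟨2 * i₀, by omega⟩, fun w => ?_⟩
    rw [← Finset.prod_erase_mul _ _ (Finset.mem_univ i₀), hrest w,
      show (⟨2 * i₀ + 1, by omega⟩ : Fin (2 * n)) = j from Fin.ext (by simp [hi₀]; omega),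
      Function.update_self, Function.update_of_ne]
    intro h
    have := congrArg Fin.val h
    simp [hi₀] at this
    omega

/-- The product of the values of a `2`-form on `n` consecutive pairs, as a multilinear map. -/
def pairingMultilinear (Ω : V [⋀^Fin 2]→L[ℝ] ℝ) (n : ℕ) :
    MultilinearMap ℝ (fun _ : Fin (2 * n) => V) ℝ :=
  MultilinearMap.mk' (fun v => ∏ i : Fin n, Ω ![v ⟨2 * i, by omega⟩, v ⟨2 * i + 1, by omega⟩])
    (by
      intro v j x y
      obtain ⟨s, u, h⟩ := exists_pairing_update Ω n v j
      rw [h, h, h, twoForm_add_right, mul_add])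
    (by
      intro v j c x
      obtain ⟨s, u, h⟩ := exists_pairing_update Ω n v j
      rw [h, h, twoForm_smul_right, smul_eq_mul, mul_left_comm])

/-- `Ω^n` as an alternating map. -/
def twoFormPowAlternating (Ω : V [⋀^Fin 2]→L[ℝ] ℝ) (n : ℕ) : V [⋀^Fin (2 * n)]→ₗ[ℝ] ℝ :=
  ((1 / 2 ^ n : ℝ)) • MultilinearMap.alternatization (pairingMultilinear Ω n)

lemma twoFormPowAlternating_apply (Ω : V [⋀^Fin 2]→L[ℝ] ℝ) (n : ℕ) (v : Fin (2 * n) → V) :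
    twoFormPowAlternating Ω n v = twoFormPow Ω n v := by
  unfold twoFormPowAlternating twoFormPow
  rw [AlternatingMap.smul_apply, MultilinearMap.alternatization_apply, smul_eq_mul]
  congr 1
  refine Finset.sum_congr rfl fun σ _ => ?_
  rw [Units.smul_def, zsmul_eq_mul]
  rfl

end TopDegree

/-! ### The standard volume form as a determinant. -/

section StandardVolume

variable {n : ℕ}

/-- The real coordinates of `ℂⁿ` as a linear equivalence. -/
def realCoordEquiv (n : ℕ) : Cn n ≃ₗ[ℝ] (Fin (2 * n) → ℝ) where
  toFun v c := realCoord v c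
  invFun x := WithLp.toLp 2 fun j => ⟨x ⟨2 * j, by omega⟩, x ⟨2 * j + 1, by omega⟩⟩
  map_add' u v := by
    ext c; simp only [realCoord, Pi.add_apply]; split_ifs <;> simp
  map_smul' c v := by
    ext i
    simp only [realCoord, Pi.smul_apply, RingHom.id_apply]
    split_ifs <;> simp
  left_inv v := by
    ext j
    apply Complex.ext
    · have : (2 * (j : ℕ)) % 2 = 0 := by omega
      simp [realCoord]
    · have : (2 * (j : ℕ) + 1) / 2 = j := by omega
      simp [realCoord, this]
  right_inv x := by
    ext c
    simp only [realCoord]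
    split_ifs with h
    · congr 1; ext; simp only []; omega
    · congr 1; ext; simp only []; omega

/-- The standard real basis of `ℂⁿ`. -/
def realBasis (n : ℕ) : Module.Basis (Fin (2 * n)) ℝ (Cn n) :=
  Module.Basis.ofEquivFun (realCoordEquiv n)

lemma finrank_Cn (n : ℕ) : Module.finrank ℝ (Cn n) = 2 * n := by
  simpa using Module.finrank_eq_card_basis (realBasis n)

lemma standardVolume_eq_det (v : Fin (2 * n) → Cn n) :
    standardVolume v = (realBasis n).det v := by
  rw [Module.Basis.det_apply, ← Matrix.det_transpose]
  rfl

lemma standardVolume_eq_zero (v : Fin (2 * n) → Cn n) (h : ¬ LinearIndependent ℝ v) :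
    standardVolume v = 0 := by
  rw [standardVolume_eq_det]
  exact (realBasis n).det.map_linearDependent v h

lemma standardVolume_ne_zero (v : Fin (2 * n) → Cn n) (h : LinearIndependent ℝ v) :
    standardVolume v ≠ 0 := by
  rw [standardVolume_eq_det]
  have := (realBasis n).isUnit_det
    (basisOfLinearIndependentOfCardEqFinrank' v h (by simp [finrank_Cn]))
  rw [coe_basisOfLinearIndependentOfCardEqFinrank'] at this
  exact this.ne_zero

lemma linearIndependent_cons_of_functional {V : Type*} [AddCommGroup V] [Module ℝ V] {m : ℕ}
    {v : Fin m → V} (hv : LinearIndependent ℝ v) (ℓ : V →ₗ[ℝ] ℝ) (h0 : ∀ i, ℓ (v i) = 0) {u : V}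
    (hu : ℓ u ≠ 0) : LinearIndependent ℝ (Fin.cons u v : Fin (m + 1) → V) := by
  rw [linearIndependent_finCons]
  refine ⟨hv, fun h => hu ?_⟩
  have : Submodule.span ℝ (Set.range v) ≤ LinearMap.ker ℓ := by
    rw [Submodule.span_le]
    rintro _ ⟨i, rfl⟩
    exact h0 i
  exact this h

/-- If the vectors formed a basis, `ℓ` would vanish identically. Later volumes are simplified by
placing all their vectors in one such hyperplane. -/
lemma standardVolume_eq_zero_of_functional (v : Fin (2 * n) → Cn n) (ℓ : Cn n →ₗ[ℝ] ℝ)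
    (hℓ : ℓ ≠ 0) (h : ∀ i, ℓ (v i) = 0) : standardVolume v = 0 := by
  refine standardVolume_eq_zero v fun hv => hℓ ?_
  refine (basisOfLinearIndependentOfCardEqFinrank' v hv (by simp [finrank_Cn])).ext fun i => ?_
  simpa using h i

end StandardVolume

/-! ### The canonical form and its exterior derivative -/

section CanonicalForm

variable {n : ℕ}

lemma canonicalForm_apply (z u : Cn n) :
    canonicalForm n z ![u] = 2 * (inner ℂ z u).im := by
  rw [canonicalForm, ContinuousAlternatingMap.ofSubsingleton_apply_apply, PiLp.inner_apply,
    Complex.im_sum, Finset.mul_sum, sum_apply]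
  refine Finset.sum_congr rfl fun j _ => ?_
  simp
  ring

/-- The canonical form as a linear function of the base point. -/
def canonicalFormLinear (n : ℕ) : Cn n →ₗ[ℝ] Cn n [⋀^Fin 1]→L[ℝ] ℝ where
  toFun := canonicalForm n
  map_add' x y := by
    ext v
    rw [ContinuousAlternatingMap.add_apply, show v = ![v 0] by ext i; fin_cases i; rfl]
    simp only [canonicalForm_apply, inner_add_left, Complex.add_im]
    ring
  map_smul' c x := by
    ext v
    rw [ContinuousAlternatingMap.smul_apply, show v = ![v 0] by ext i; fin_cases i; rfl]
    simp only [canonicalForm_apply, RingHom.id_apply, smul_eq_mul]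
    rw [show c • x = (c : ℂ) • x from rfl, inner_smul_left]
    simp
    ring

lemma contDiff_canonicalForm : ContDiff ℝ ∞ (canonicalForm n) :=
  (LinearMap.toContinuousLinearMap (canonicalFormLinear n)).contDiff

lemma fderiv_canonicalForm (x u : Cn n) : fderiv ℝ (canonicalForm n) x u = canonicalForm n u := by
  have := (LinearMap.toContinuousLinearMap (canonicalFormLinear n)).hasFDerivAt (x := x)
  exact congrArg (fun L => L u) (HasFDerivAt.fderiv (f := canonicalForm n) this)

/-- `α` is linear in the base point, so `dα(u, w) = α_u(w) - α_w(u)`, and the skew symmetry of `Im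
⟨u,w⟩` doubles the coefficient. The base point drops out: `ω` is constant. -/
lemma extDeriv_canonicalForm (x u w : Cn n) :
    extDeriv (canonicalForm n) x ![u, w] = 4 * (inner ℂ u w).im := by
  rw [extDeriv, ContinuousAlternatingMap.alternatizeUncurryFin_apply]
  have e0 : (0 : Fin 2).removeNth ![u, w] = ![w] := by ext i; fin_cases i; rfl
  have e1 : (1 : Fin 2).removeNth ![u, w] = ![u] := by ext i; fin_cases i; rfl
  rw [Fin.sum_univ_two, e0, e1]
  have hs : (inner ℂ w u).im = -(inner ℂ u w).im := by
    rw [← inner_conj_symm, Complex.conj_im]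
  simp [fderiv_canonicalForm, canonicalForm_apply, hs]
  ring

lemma extDeriv_extDeriv_canonicalForm (x : Cn n) (v : Fin 3 → Cn n) :
    extDeriv (extDeriv (canonicalForm n)) x v = 0 := by
  rw [extDeriv_extDeriv contDiff_canonicalForm (by simpa using (mod_cast le_top : ((2 : ℕ∞) : WithTop ℕ∞) ≤ ∞))]
  rfl

lemma realBasis_pairEquiv (i : Fin n) (s : Fin 2) :
    realBasis n (pairEquiv n (i, s)) =
      EuclideanSpace.single i (if s = 0 then (1 : ℂ) else Complex.I) := by
  apply (realCoordEquiv n).injective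
  have : realCoordEquiv n (realBasis n (pairEquiv n (i, s))) = Pi.single (pairEquiv n (i, s)) 1 := by
    simp [realBasis, Module.Basis.ofEquivFun]
  rw [this]
  ext c
  obtain ⟨⟨j, t⟩, rfl⟩ := (pairEquiv n).surjective c
  have hval := pairEquiv_val j t
  have hd : (pairEquiv n (j, t) : ℕ) / 2 = j := by omega
  have hm : (pairEquiv n (j, t) : ℕ) % 2 = t := by omega
  have hR : realCoordEquiv n (EuclideanSpace.single i (if s = 0 then (1 : ℂ) else Complex.I))
      (pairEquiv n (j, t)) =
      realCoord (EuclideanSpace.single i (if s = 0 then (1 : ℂ) else Complex.I))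
        (pairEquiv n (j, t)) := rfl
  rw [hR]
  simp only [realCoord, hd, hm, Fin.eta, PiLp.single_apply, Pi.single_apply,
    (pairEquiv n).injective.eq_iff, Prod.mk.injEq]
  by_cases hij : j = i
  · fin_cases s <;> fin_cases t <;> simp [hij]
  · simp [hij]

/-- The top power of `dα` is a positive multiple of the standard volume form. -/
lemma exists_twoFormPow_eq_standardVolume (n : ℕ) : ∃ C : ℝ, 0 < C ∧
    ∀ (x : Cn n) (v : Fin (2 * n) → Cn n),
      twoFormPow (extDeriv (canonicalForm n) x) n v = C * standardVolume v := by
  -- A top-degree alternating form is its value on a basis times the determinant. The standard basis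
  -- consists of mutually `ω`-orthogonal pairs `(e_j, i e_j)` with `ω(e_j, i e_j) = 4`, so this
  -- value is positive.
  refine ⟨twoFormPow (extDeriv (canonicalForm n) 0) n (realBasis n), ?_, fun x v => ?_⟩
  · rw [twoFormPow_eq]
    refine mul_pos (by positivity) (sum_pairingTerm_pos (twoForm_swap _) n _ (fun i => ?_) ?_)
    · rw [extDeriv_canonicalForm, realBasis_pairEquiv, realBasis_pairEquiv,
        EuclideanSpace.inner_single_left]
      simp
    · intro i j s t hij
      rw [extDeriv_canonicalForm, realBasis_pairEquiv, realBasis_pairEquiv,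
        EuclideanSpace.inner_single_left]
      simp [hij]
  · have hx : twoFormPow (extDeriv (canonicalForm n) x) n v =
        twoFormPow (extDeriv (canonicalForm n) 0) n v := by
      simp only [twoFormPow, extDeriv_canonicalForm]
    have h := congrArg (fun F => F v) ((twoFormPowAlternating
      (extDeriv (canonicalForm n) 0) n).eq_smul_basis_det (realBasis n))
    simp only [AlternatingMap.smul_apply, twoFormPowAlternating_apply, smul_eq_mul] at h
    rw [hx, h, standardVolume_eq_det]

end CanonicalForm

/-! ### Contact and symplectic volumes in terms of the standard volume form -/

section AlternatingCons

variable {V : Type*} [AddCommGroup V] [Module ℝ V] {m : ℕ}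

lemma alternating_cons_swap (F : V [⋀^Fin (m + 2)]→ₗ[ℝ] ℝ) (a b : V) (w : Fin m → V) :
    F (Fin.cons a (Fin.cons b w : Fin (m + 1) → V)) =
      -F (Fin.cons b (Fin.cons a w : Fin (m + 1) → V)) := by
  rw [← F.map_swap _ (i := 0) (j := 1) (by simp)]
  congr 1
  ext i
  refine Fin.cases (by simp) (fun i => Fin.cases ?_ (fun i => ?_) i) i
  · simp
  · rw [Function.comp_apply, Equiv.swap_apply_of_ne_of_ne]
    · simp
    · simp
    · exact Fin.succ_succ_ne_one i

lemma alternating_cons_swap_zero_two (F : V [⋀^Fin (m + 3)]→ₗ[ℝ] ℝ) (a b c : V) (w : Fin m → V) :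
    F (Fin.cons a (Fin.cons b (Fin.cons c w : Fin (m + 1) → V) : Fin (m + 2) → V)) =
      -F (Fin.cons c (Fin.cons b (Fin.cons a w : Fin (m + 1) → V) : Fin (m + 2) → V)) := by
  have h := alternating_cons_swap (F.curryLeft b) a c w
  change F (Fin.cons b (Fin.cons a (Fin.cons c w : Fin (m + 1) → V) : Fin (m + 2) → V)) =
    -F (Fin.cons b (Fin.cons c (Fin.cons a w : Fin (m + 1) → V) : Fin (m + 2) → V)) at h
  rw [alternating_cons_swap F a b, h, alternating_cons_swap F b c, neg_neg]

lemma alternating_cons_add (F : V [⋀^Fin (m + 1)]→ₗ[ℝ] ℝ) (a b : V) (w : Fin m → V) :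
    F (Fin.cons (a + b) w) = F (Fin.cons a w) + F (Fin.cons b w) :=
  F.toMultilinearMap.cons_add w a b

lemma alternating_cons_smul (F : V [⋀^Fin (m + 1)]→ₗ[ℝ] ℝ) (c : ℝ) (a : V) (w : Fin m → V) :
    F (Fin.cons (c • a) w) = c * F (Fin.cons a w) :=
  F.toMultilinearMap.cons_smul w c a

lemma alternating_cons_self (F : V [⋀^Fin (m + 2)]→ₗ[ℝ] ℝ) (a : V) (w : Fin m → V) :
    F (Fin.cons a (Fin.cons a w : Fin (m + 1) → V)) = 0 := by
  have := alternating_cons_swap F a a w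
  linarith

end AlternatingCons

variable {k : ℕ}

lemma oneFormWedgePow_smul {V : Type*} [NormedAddCommGroup V] [NormedSpace ℝ V]
    (β : V [⋀^Fin 1]→L[ℝ] ℝ) (Ω : V [⋀^Fin 2]→L[ℝ] ℝ) (m : ℕ) (c : ℝ) (v : Fin (2 * m + 1) → V) :
    oneFormWedgePow (c • β) Ω m v = c * oneFormWedgePow β Ω m v := by
  unfold oneFormWedgePow
  rw [mul_left_comm c, Finset.mul_sum _ _ c]
  congr 1
  refine Finset.sum_congr rfl fun σ _ => ?_
  rw [ContinuousAlternatingMap.smul_apply, smul_eq_mul]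
  ring

/-- The position vector is a Liouville field: `ι_z ω = 2 α_z`. -/
lemma twoFormPow_cons_self {n m : ℕ} (z : Cn n) (v : Fin (2 * m + 1) → Cn n) :
    twoFormPow (extDeriv (canonicalForm n) z) (m + 1) (Fin.cons z v : Fin (2 * m + 2) → Cn n) =
      2 * (m + 1) * contactVolume (canonicalForm n) m z v := by
  rw [twoFormPow_cons _ ((2 : ℝ) • canonicalForm n z), oneFormWedgePow_smul, contactVolume]
  · ring
  · intro u
    rw [ContinuousAlternatingMap.smul_apply, canonicalForm_apply, extDeriv_canonicalForm,
      smul_eq_mul]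
    ring

/-- Both sides are contractions of top-degree forms with `z`. This settles at once that `α` is
contact and positive on the spheres. -/
lemma exists_contactVolume_eq_sphereVolume (k : ℕ) : ∃ C : ℝ, 0 < C ∧
    ∀ (z : Cn (k + 2)) (v : Fin (2 * k + 3) → Cn (k + 2)),
      contactVolume (canonicalForm (k + 2)) (k + 1) z v = C * sphereVolume k z v := by
  obtain ⟨C, hC, h⟩ := exists_twoFormPow_eq_standardVolume (k + 2)
  refine ⟨C / (2 * ((k + 1 : ℕ) + 1)), by positivity, fun z v => ?_⟩
  have h1 := twoFormPow_cons_self (m := k + 1) z v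
  have h2 := h z (Fin.cons z v : Fin (2 * k + 4) → Cn (k + 2))
  rw [sphereVolume, div_mul_eq_mul_div, eq_div_iff (by positivity), ← h2]
  rw [mul_comm]
  exact h1.symm

/-- `α ∧ (dα)^m (Jz, v) = α(Jz) (dα)^m (v)` if `v` is orthogonal to `z`. -/
lemma contactVolume_cons_I_smul {n m : ℕ} (z : Cn n) (v : Fin (2 * m) → Cn n)
    (hv : ∀ i, (inner ℂ z (v i)).re = 0) :
    contactVolume (canonicalForm n) m z (Fin.cons (Complex.I • z) v : Fin (2 * m + 1) → Cn n) =
      2 * ‖z‖ ^ 2 * twoFormPow (extDeriv (canonicalForm n) z) m v := by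
  rw [contactVolume, oneFormWedgePow_cons, canonicalForm_apply, inner_smul_right,
    inner_self_eq_norm_sq_to_K]
  · congr 1
    rw [← Complex.ofReal_re (‖z‖ ^ 2)]
    simp [← Complex.ofReal_pow]
  · intro i
    rw [extDeriv_canonicalForm, inner_smul_left]
    simp [hv i]

/-- A real linear map to `ℂ` whose kernel is symplectic for `dα`, with a symplectic pair spanning
the complement of the kernel. -/
structure IsSymplecticPair {n : ℕ} (L : Cn n →ₗ[ℝ] ℂ) (ξ₁ ξ₂ : Cn n) : Prop where
  re_eq : ∀ v, 4 * (inner ℂ ξ₁ v).im = (L v).re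
  im_eq : ∀ v, 4 * (inner ℂ ξ₂ v).im = (L v).im
  pos : 0 < (L ξ₂).re

namespace IsSymplecticPair

variable {n : ℕ} {L : Cn n →ₗ[ℝ] ℂ} {ξ₁ ξ₂ : Cn n}

lemma inner_im_swap (u v : Cn n) : (inner ℂ u v).im = -(inner ℂ v u).im := by
  rw [← inner_conj_symm, Complex.conj_im]

lemma inner_self_im (u : Cn n) : (inner ℂ u u).im = 0 := by
  have := inner_im_swap u u
  linarith

lemma re_left (h : IsSymplecticPair L ξ₁ ξ₂) : (L ξ₁).re = 0 := by
  rw [← h.re_eq, inner_self_im, mul_zero]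

lemma im_right (h : IsSymplecticPair L ξ₁ ξ₂) : (L ξ₂).im = 0 := by
  rw [← h.im_eq, inner_self_im, mul_zero]

lemma im_left (h : IsSymplecticPair L ξ₁ ξ₂) : (L ξ₁).im = -(L ξ₂).re := by
  rw [← h.im_eq, ← h.re_eq, inner_im_swap]; ring

lemma surjective (h : IsSymplecticPair L ξ₁ ξ₂) : Function.Surjective L := by
  intro c
  refine ⟨(-c.im / (L ξ₂).re) • ξ₁ + (c.re / (L ξ₂).re) • ξ₂, ?_⟩
  have := h.pos.ne'
  apply Complex.ext
  · simp [h.re_left]; field_simp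
  · simp [h.im_right, h.im_left]; field_simp

lemma sub_mem_ker (h : IsSymplecticPair L ξ₁ ξ₂) (q : Cn n) :
    L (q - ((-(L q).im / (L ξ₂).re) • ξ₁ + ((L q).re / (L ξ₂).re) • ξ₂)) = 0 := by
  have := h.pos.ne'
  apply Complex.ext
  · simp [h.re_left]; field_simp; simp
  · simp [h.im_right, h.im_left]; field_simp; simp

end IsSymplecticPair

/-- The canonical volume of the kernel compared with the standard volume form. -/
lemma exists_contactVolume_eq_standardVolume {L : Cn (k + 2) →ₗ[ℝ] ℂ} {ξ₁ ξ₂ : Cn (k + 2)}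
    (h : IsSymplecticPair L ξ₁ ξ₂) : ∃ C : ℝ, 0 < C ∧
    ∀ (x : Cn (k + 2)) (w : Fin (2 * k + 1) → Cn (k + 2)), L x = 0 → (∀ i, L (w i) = 0) →
      contactVolume (canonicalForm (k + 2)) k x w = C * standardVolume (n := k + 2)
        (Fin.cons ξ₁ (Fin.cons ξ₂ (Fin.cons x w : Fin (2 * k + 2) → Cn (k + 2)) :
          Fin (2 * k + 3) → Cn (k + 2)) : Fin (2 * k + 4) → Cn (k + 2)) := by
  obtain ⟨C, hC, hvol⟩ := exists_twoFormPow_eq_standardVolume (k + 2)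
  have hpos := h.pos
  refine ⟨C / ((((k + 1 : ℕ) : ℝ) + 1) * (L ξ₂).re * (2 * (k + 1))), by positivity,
    fun x w hx hw => ?_⟩
  set Ω := extDeriv (canonicalForm (k + 2)) x with hΩ
  -- This is `ι_{ξ₁} ω`. Contracting `ω^(k+2)` with `ξ₁`, then `ξ₂`, leaves `Re L(ξ₂) ω^(k+1)` on
  -- the kernel, because `ω(ξ₂, ·) = Im L` vanishes there; the last contraction is with `x`.
  set β : Cn (k + 2) [⋀^Fin 1]→L[ℝ] ℝ := (2 : ℝ) • canonicalForm (k + 2) ξ₁ with hβ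
  have hβ' : ∀ u, β ![u] = Ω ![ξ₁, u] := by
    intro u
    rw [hβ, ContinuousAlternatingMap.smul_apply, canonicalForm_apply, hΩ, extDeriv_canonicalForm,
      smul_eq_mul]
    ring
  have h1 := twoFormPow_cons Ω β (k + 1) ξ₁ hβ'
    (Fin.cons ξ₂ (Fin.cons x w : Fin (2 * k + 2) → Cn (k + 2)))
  have h2 := oneFormWedgePow_cons Ω β (k + 1) ξ₂ (Fin.cons x w : Fin (2 * k + 2) → Cn (k + 2)) (by
    intro i
    rw [hΩ, extDeriv_canonicalForm, h.im_eq]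
    refine Fin.cases ?_ (fun j => ?_) i
    · simp [hx]
    · simp [hw j])
  have h3 := twoFormPow_cons_self (m := k) x w
  have h4 := hvol x (Fin.cons ξ₁ (Fin.cons ξ₂ (Fin.cons x w : Fin (2 * k + 2) → Cn (k + 2)) :
          Fin (2 * k + 3) → Cn (k + 2)) : Fin (2 * k + 4) → Cn (k + 2))
  rw [div_mul_eq_mul_div, eq_div_iff (by positivity), ← h4]
  refine Eq.trans ?_ h1.symm
  refine Eq.trans ?_ (congrArg _ h2.symm)
  rw [hβ', hΩ, extDeriv_canonicalForm, h.re_eq]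
  refine Eq.trans ?_ (congrArg (fun t => (((k + 1 : ℕ) : ℝ) + 1) * ((L ξ₂).re * t)) h3.symm)
  ring

/-- Compose `L` with a non-zero real functional on `ℂ` that kills `p`, namely `y ↦ Re (c y)` with `c
= i conj p` when `p ≠ 0`. -/
lemma exists_functional_of_surjective {n : ℕ} {L : Cn n →ₗ[ℝ] ℂ} (hL : Function.Surjective L)
    (p : ℂ) : ∃ ℓ : Cn n →ₗ[ℝ] ℝ, ℓ ≠ 0 ∧ ∀ v, (L v = 0 ∨ L v = p) → ℓ v = 0 := by
  obtain ⟨c, hc0, hc⟩ : ∃ c : ℂ, c ≠ 0 ∧ (c * p).re = 0 := by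
    by_cases hp : p = 0
    · exact ⟨1, one_ne_zero, by simp [hp]⟩
    · refine ⟨Complex.I * conj p, by simpa using hp, ?_⟩
      rw [mul_assoc, mul_comm (conj p), Complex.mul_conj]
      simp
  refine ⟨Complex.reLm ∘ₗ (LinearMap.mulLeft ℝ c) ∘ₗ L, fun h => ?_, ?_⟩
  · obtain ⟨v, hv⟩ := hL c⁻¹
    have := congrArg (fun f => f v) h
    simp [hv, hc0] at this
  · rintro v (hv | hv)
    · simp [hv]
    · simpa [hv] using hc

/-- With `w` in the kernel of `L`, the volume depends on `q` and `p` only through `L q` and `L p`,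
hence is a multiple of the area form `Im (conj (L q) L p)` of `ℂ`. At `(ξ₁, ξ₂)` that area is `(Re L
ξ₂)²`. -/
lemma standardVolume_cons_cons {L : Cn (k + 2) →ₗ[ℝ] ℂ} {ξ₁ ξ₂ : Cn (k + 2)}
    (h : IsSymplecticPair L ξ₁ ξ₂) (q p : Cn (k + 2)) (w : Fin (2 * k + 2) → Cn (k + 2))
    (hw : ∀ i, L (w i) = 0) :
    standardVolume (n := k + 2) (Fin.cons q (Fin.cons p w : Fin (2 * k + 3) → Cn (k + 2)) :
        Fin (2 * k + 4) → Cn (k + 2)) =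
      (conj (L q) * L p).im / (L ξ₂).re ^ 2 *
      standardVolume (n := k + 2) (Fin.cons ξ₁ (Fin.cons ξ₂ w : Fin (2 * k + 3) → Cn (k + 2)) :
        Fin (2 * k + 4) → Cn (k + 2)) := by
  set F : Cn (k + 2) [⋀^Fin (2 * k + 2 + 2)]→ₗ[ℝ] ℝ := (realBasis (k + 2)).det with hF
  have hvol : ∀ a b : Cn (k + 2),
      standardVolume (n := k + 2) (Fin.cons a (Fin.cons b w : Fin (2 * k + 3) → Cn (k + 2)) :
        Fin (2 * k + 4) → Cn (k + 2)) = F (Fin.cons a (Fin.cons b w : Fin (2 * k + 3) → _)) :=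
    fun a b => standardVolume_eq_det _
  have hker : ∀ a b : Cn (k + 2), L a = 0 →
      F (Fin.cons a (Fin.cons b w : Fin (2 * k + 3) → _)) = 0 := by
    intro a b ha
    rw [← hvol]
    obtain ⟨ℓ, hℓ, hℓ0⟩ := exists_functional_of_surjective h.surjective (L b)
    refine standardVolume_eq_zero_of_functional _ ℓ hℓ fun i => hℓ0 _ ?_
    refine Fin.cases ?_ (fun i => Fin.cases ?_ (fun i => ?_) i) i
    · exact Or.inl ha
    · exact Or.inr rfl
    · exact Or.inl (hw i)
  have hexp : ∀ a b : Cn (k + 2), F (Fin.cons a (Fin.cons b w : Fin (2 * k + 3) → _)) =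
      (-(L a).im / (L ξ₂).re) * F (Fin.cons ξ₁ (Fin.cons b w : Fin (2 * k + 3) → _)) +
      ((L a).re / (L ξ₂).re) * F (Fin.cons ξ₂ (Fin.cons b w : Fin (2 * k + 3) → _)) := by
    intro a b
    have h0 := hker _ b (h.sub_mem_ker a)
    conv_lhs => rw [← sub_add_cancel a ((-(L a).im / (L ξ₂).re) • ξ₁ + ((L a).re / (L ξ₂).re) • ξ₂)]
    rw [alternating_cons_add, h0, zero_add, alternating_cons_add, alternating_cons_smul,
      alternating_cons_smul]
  have hpos := h.pos.ne'
  rw [hvol, hvol, hexp q p, alternating_cons_swap F ξ₁ p, alternating_cons_swap F ξ₂ p, hexp p ξ₁,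
    hexp p ξ₂, alternating_cons_self, alternating_cons_self, alternating_cons_swap F ξ₂ ξ₁]
  simp only [Complex.mul_im, Complex.conj_re, Complex.conj_im]
  field_simp
  ring

/-! ### Tubular neighbourhoods of compact regular level sets -/

section Tubular

open scoped Topology

/-- A smooth map that is injective on a compact set and has invertible derivatives there restricts to
a diffeomorphism of a neighbourhood of the compact set onto an open set. -/
lemma exists_smooth_inverse_near_compact {E F : Type*} [NormedAddCommGroup E] [NormedSpace ℝ E]
    [FiniteDimensional ℝ E] [NormedAddCommGroup F] [NormedSpace ℝ F] [FiniteDimensional ℝ F]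
    (hdim : Module.finrank ℝ E = Module.finrank ℝ F) {f : E → F} (hf : ContDiff ℝ ∞ f) {C : Set E}
    (hC : IsCompact C) (hinj : Set.InjOn f C)
    (hd : ∀ x ∈ C, Function.Injective (fderiv ℝ f x)) :
    ∃ N : Set E, IsOpen N ∧ C ⊆ N ∧ (∀ N' ⊆ N, IsOpen N' → IsOpen (f '' N')) ∧
      ∃ S : F → E, ContDiffOn ℝ ∞ S (f '' N) ∧ ∀ x ∈ N, S (f x) = x := by
  have : CompleteSpace E := FiniteDimensional.complete ℝ E
  set D : Set E := {x | fderiv ℝ f x ∈ Set.range ((↑) : (E ≃L[ℝ] F) → E →L[ℝ] F)} with hD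
  have hne : (∞ : WithTop ℕ∞) ≠ 0 := by simp
  have hDopen : IsOpen D :=
    ContinuousLinearEquiv.isOpen.preimage (hf.continuous_fderiv hne)
  have hCD : C ⊆ D := by
    intro x hx
    refine ⟨(LinearEquiv.ofInjectiveOfFinrankEq (fderiv ℝ f x : E →ₗ[ℝ] F) (hd x hx)
      hdim).toContinuousLinearEquiv, ?_⟩
    ext v
    rfl
  have hstrict : ∀ (x : E) (e : E ≃L[ℝ] F), (e : E →L[ℝ] F) = fderiv ℝ f x →
      HasStrictFDerivAt f (e : E →L[ℝ] F) x := fun x e he =>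
    he ▸ hf.contDiffAt.hasStrictFDerivAt hne
  -- Injectivity on the compact set together with local injectivity at its points gives injectivity
  -- on a neighbourhood of it.
  obtain ⟨t, ht, htinj⟩ := hinj.exists_mem_nhdsSet hC (fun x _ => hf.continuous.continuousAt) (by
    intro x hx
    obtain ⟨e, he⟩ := hCD hx
    set φ := (hstrict x e he).toOpenPartialHomeomorph f
    exact ⟨φ.source, φ.open_source.mem_nhds (hstrict x e he).mem_toOpenPartialHomeomorph_source,
      φ.injOn⟩)
  obtain ⟨U, hU, hCU, hUt⟩ := mem_nhdsSet_iff_exists.1 ht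
  have hNinj : Set.InjOn f (U ∩ D) := htinj.mono (Set.inter_subset_left.trans hUt)
  refine ⟨U ∩ D, hU.inter hDopen, Set.subset_inter hCU hCD, ?_, Function.invFunOn f (U ∩ D), ?_,
    fun x hx => hNinj.leftInvOn_invFunOn hx⟩
  · intro N' hN' hN'o
    rw [isOpen_iff_mem_nhds]
    rintro _ ⟨x, hx, rfl⟩
    obtain ⟨e, he⟩ := (hN' hx).2
    rw [← (hstrict x e he).map_nhds_eq_of_equiv]
    exact Filter.image_mem_map (hN'o.mem_nhds hx)
  · rintro _ ⟨x, hx, rfl⟩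
    obtain ⟨e, he⟩ := hx.2
    have hs := hstrict x e he
    have hloc : ContDiffAt ℝ ∞ (hs.localInverse f e x) (f x) :=
      ContDiffAt.to_localInverse hf.contDiffAt hs.hasFDerivAt hne
    refine ContDiffAt.contDiffWithinAt (hloc.congr_of_eventuallyEq ?_)
    -- The local inverse near `f x` takes its values in the set where `f` is injective, so it agrees
    -- there with the chosen global inverse.
    have hmem : ∀ᶠ y in 𝓝 (f x), hs.localInverse f e x y ∈ U ∩ D := by
      refine hloc.continuousAt.eventually_mem ?_
      rw [hs.localInverse_apply_image]
      exact (hU.inter hDopen).mem_nhds hx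
    filter_upwards [hmem, hs.eventually_right_inverse] with y hy hy'
    conv_lhs => rw [← hy']
    exact hNinj.leftInvOn_invFunOn hy

variable {V W : Type*} [NormedAddCommGroup V] [NormedSpace ℝ V] [FiniteDimensional ℝ V]
  [NormedAddCommGroup W] [InnerProductSpace ℝ W]

/-- The transpose of the derivative of `G` with respect to the inner product of `W` and a basis of
`V`. -/
def transposeFDeriv (G : V → W) (p : V × W) : V :=
  ∑ i, (inner ℝ (fderiv ℝ G p.1 (Module.finBasis ℝ V i)) p.2 : ℝ) • Module.finBasis ℝ V i

lemma transposeFDeriv_zero (G : V → W) (x : V) : transposeFDeriv G (x, 0) = 0 := by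
  simp [transposeFDeriv]

lemma contDiff_transposeFDeriv {G : V → W} (hG : ContDiff ℝ ∞ G) :
    ContDiff ℝ ∞ (transposeFDeriv G) := by
  have h : ContDiff ℝ ∞ (fderiv ℝ G) := hG.fderiv_right (by simp)
  unfold transposeFDeriv
  refine ContDiff.sum fun i _ => ContDiff.smul (ContDiff.inner ℝ ?_ contDiff_snd) contDiff_const
  exact (h.comp contDiff_fst).clm_apply contDiff_const

/-- The map is linear in its second variable, so on the zero section moving the base point
contributes nothing. -/
lemma fderiv_transposeFDeriv {G : V → W} (hG : ContDiff ℝ ∞ G) (x u : V) (c : W) :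
    fderiv ℝ (transposeFDeriv G) (x, 0) (u, c) = transposeFDeriv G (x, c) := by
  have h : ContDiff ℝ ∞ (fderiv ℝ G) := hG.fderiv_right (by simp)
  have hi : ∀ i, HasFDerivAt (fun p : V × W => fderiv ℝ G p.1 (Module.finBasis ℝ V i))
      (fderiv ℝ (fun p : V × W => fderiv ℝ G p.1 (Module.finBasis ℝ V i)) (x, 0)) (x, 0) :=
    fun i => (((h.comp contDiff_fst).clm_apply contDiff_const).differentiable (by simp)
      _).hasFDerivAt
  have hsum : HasFDerivAt (transposeFDeriv G) _ (x, (0 : W)) :=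
    HasFDerivAt.fun_sum (u := Finset.univ) fun i _ =>
    ((hi i).inner ℝ (hasFDerivAt_snd (𝕜 := ℝ) (E := V) (F := W))).smul_const
      (Module.finBasis ℝ V i)
  rw [hsum.fderiv]
  simp [transposeFDeriv, fderivInnerCLM_apply]

/-- Pairing with `c` yields `∑ ⟨dG e_i, c⟩² = 0`, so `c` is orthogonal to the image of `dG`, which
is everything. -/
lemma transposeFDeriv_injective {G : V → W} {x : V} (hx : Function.Surjective (fderiv ℝ G x))
    {c : W} (hc : fderiv ℝ G x (transposeFDeriv G (x, c)) = 0) : c = 0 := by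
  have h1 : ∑ i, (inner ℝ (fderiv ℝ G x (Module.finBasis ℝ V i)) c : ℝ) ^ 2 = 0 := by
    have := congrArg (fun w => inner ℝ w c) hc
    simp only [transposeFDeriv, map_sum, map_smul, sum_inner, inner_smul_left, inner_zero_left]
      at this
    rw [← this]
    refine Finset.sum_congr rfl fun i _ => ?_
    simp [sq]
  have h2 : ∀ i, (inner ℝ (fderiv ℝ G x (Module.finBasis ℝ V i)) c : ℝ) = 0 := by
    intro i
    have := (Finset.sum_eq_zero_iff_of_nonneg fun i _ => sq_nonneg _).1 h1 i (Finset.mem_univ i)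
    exact pow_eq_zero_iff (two_ne_zero) |>.1 this
  obtain ⟨v, hv⟩ := hx c
  have h3 : (inner ℝ (fderiv ℝ G x v) c : ℝ) = 0 := by
    rw [← (Module.finBasis ℝ V).sum_repr v, map_sum, sum_inner]
    refine Finset.sum_eq_zero fun i _ => ?_
    rw [map_smul, inner_smul_left, h2, mul_zero]
  rw [hv] at h3
  exact inner_self_eq_zero.1 h3

/-- A compact regular level set has a trivial tubular neighbourhood on which the map is the second
projection. -/
theorem exists_trivial_tubular_nhds [FiniteDimensional ℝ W] {G : V → W} (hG : ContDiff ℝ ∞ G)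
    (hK : IsCompact (G ⁻¹' {0})) (hsub : ∀ x, G x = 0 → Function.Surjective (fderiv ℝ G x)) :
    ∃ δ > 0, ∃ O : Set V, IsOpen O ∧ G ⁻¹' {0} ⊆ O ∧ ∃ (T : V × W → V) (π : V → V) (U : Set (V × W)),
      IsOpen U ∧ (G ⁻¹' {0}) ×ˢ Metric.ball 0 δ ⊆ U ∧ ContDiffOn ℝ ∞ T U ∧ ContDiffOn ℝ ∞ π O ∧
      (∀ x, G x = 0 → T (x, 0) = x) ∧
      (∀ x, G x = 0 → ∀ w ∈ Metric.ball (0 : W) δ,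
        T (x, w) ∈ O ∧ G (T (x, w)) = w ∧ π (T (x, w)) = x) ∧
      ∀ y ∈ O, G y ∈ Metric.ball 0 δ ∧ G (π y) = 0 ∧ T (π y, G y) = y := by
  set K := G ⁻¹' {0} with hKdef
  set A := transposeFDeriv G with hA
  have hAs : ContDiff ℝ ∞ A := contDiff_transposeFDeriv hG
  -- A point near the level set is `x + A (x, c)` with `G x = 0`. Inverting `P` at `(0, y)` recovers
  -- `x` and `c` from `y`; inverting `Q` recovers `c` from `x` and the value of `G`. The component
  -- `G x` in `P` replaces the restriction to the level set, so only open subsets of vector spaces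
  -- occur.
  set P : V × W → W × V := fun p => (G p.1, p.1 + A p) with hP
  set Q : V × W → V × W := fun p => (p.1, G (p.1 + A p)) with hQ
  have hPs : ContDiff ℝ ∞ P :=
    (hG.comp contDiff_fst).prodMk (contDiff_fst.add hAs)
  have hQs : ContDiff ℝ ∞ Q :=
    contDiff_fst.prodMk (hG.comp (contDiff_fst.add hAs))
  have hA0 : ∀ x, A (x, 0) = 0 := transposeFDeriv_zero G
  have hGd : ∀ x, HasFDerivAt G (fderiv ℝ G x) x :=
    fun x => (hG.differentiable (by simp) x).hasFDerivAt
  have hAd : ∀ x, HasFDerivAt A (fderiv ℝ A (x, 0)) (x, 0) :=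
    fun x => (hAs.differentiable (by simp) _).hasFDerivAt
  have hsumd : ∀ x : V, HasFDerivAt (fun p : V × W => p.1 + A p)
      (ContinuousLinearMap.fst ℝ V W + fderiv ℝ A (x, 0)) (x, 0) :=
    fun x => hasFDerivAt_fst.add (hAd x)
  have hPd : ∀ (x u : V) (c : W), fderiv ℝ P (x, 0) (u, c) = (fderiv ℝ G x u, u + A (x, c)) := by
    intro x u c
    have h : HasFDerivAt P _ (x, (0 : W)) :=
      (HasFDerivAt.comp (x, (0 : W)) (hGd x) hasFDerivAt_fst).prodMk (hsumd x)
    rw [h.fderiv]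
    simp [hA, fderiv_transposeFDeriv hG]
  have hQd : ∀ (x u : V) (c : W), fderiv ℝ Q (x, 0) (u, c) =
      (u, fderiv ℝ G x (u + A (x, c))) := by
    intro x u c
    have hG' : HasFDerivAt G (fderiv ℝ G x) ((x, (0 : W)).1 + A (x, 0)) := by
      simpa [hA0] using hGd x
    have h : HasFDerivAt Q _ (x, (0 : W)) :=
      hasFDerivAt_fst.prodMk (HasFDerivAt.comp (x, (0 : W)) hG' (hsumd x))
    rw [h.fderiv]
    simp [hA, fderiv_transposeFDeriv hG]
  have hCc : IsCompact (K ×ˢ ({0} : Set W)) := hK.prod isCompact_singleton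
  have hP0 : ∀ x ∈ K, P (x, 0) = (0, x) := fun x hx => by
    have : G x = 0 := hx
    simp [hP, hA0, this]
  have hQ0 : ∀ x ∈ K, Q (x, 0) = (x, 0) := fun x hx => by
    have : G x = 0 := hx
    simp [hQ, hA0, this]
  obtain ⟨NP, hNPo, hNPC, hNPim, SP, hSP, hSPinv⟩ := exists_smooth_inverse_near_compact
    (by simp [add_comm]) hPs hCc (by
      rintro ⟨x, c⟩ ⟨hx, hc⟩ ⟨y, c'⟩ ⟨hy, hc'⟩ hxy
      obtain rfl : c = 0 := hc
      obtain rfl : c' = 0 := hc'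
      rw [hP0 x hx, hP0 y hy] at hxy
      exact Prod.ext (Prod.ext_iff.1 hxy).2 rfl) (by
      rintro ⟨x, c⟩ ⟨hx, hc⟩
      obtain rfl : c = 0 := hc
      rw [injective_iff_map_eq_zero]
      rintro ⟨u, c⟩ huc
      rw [hPd, Prod.mk_eq_zero] at huc
      have hc0 : c = 0 := by
        refine transposeFDeriv_injective (hsub x hx) ?_
        have : transposeFDeriv G (x, c) = -u := by rw [eq_neg_iff_add_eq_zero, add_comm]; exact huc.2
        rw [this, map_neg, huc.1, neg_zero]
      subst hc0
      simpa [hA0] using huc.2)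
  obtain ⟨NQ, hNQo, hNQC, hNQim, SQ, hSQ, hSQinv⟩ := exists_smooth_inverse_near_compact
    rfl hQs hCc (by
      rintro ⟨x, c⟩ ⟨hx, hc⟩ ⟨y, c'⟩ ⟨hy, hc'⟩ hxy
      obtain rfl : c = 0 := hc
      obtain rfl : c' = 0 := hc'
      rwa [hQ0 x hx, hQ0 y hy] at hxy) (by
      rintro ⟨x, c⟩ ⟨hx, hc⟩
      obtain rfl : c = 0 := hc
      rw [injective_iff_map_eq_zero]
      rintro ⟨u, c⟩ huc
      rw [hQd, Prod.mk_eq_zero] at huc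
      obtain ⟨rfl, huc⟩ := huc
      rw [zero_add] at huc
      rw [transposeFDeriv_injective (hsub x hx) huc]
      rfl)
  set N := NP ∩ NQ
  have hNo : IsOpen N := hNPo.inter hNQo
  have hNC : K ×ˢ ({0} : Set W) ⊆ N := Set.subset_inter hNPC hNQC
  have hPN : IsOpen (P '' N) := hNPim N Set.inter_subset_left hNo
  have hQN : IsOpen (Q '' N) := hNQim N Set.inter_subset_right hNo
  have hKQ : K ×ˢ ({0} : Set W) ⊆ Q '' N := by
    rintro ⟨x, c⟩ ⟨hx, hc⟩
    obtain rfl : c = 0 := hc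
    exact ⟨(x, 0), hNC ⟨hx, rfl⟩, hQ0 x hx⟩
  -- Compactness of the level set makes the radius uniform.
  obtain ⟨δ, hδ, hδQ⟩ := hCc.exists_thickening_subset_open hQN hKQ
  have hball : K ×ˢ Metric.ball (0 : W) δ ⊆ Q '' N := by
    rintro ⟨x, w⟩ ⟨hx, hw⟩
    refine hδQ (Metric.mem_thickening_iff.2 ⟨(x, 0), ⟨hx, rfl⟩, ?_⟩)
    rw [Prod.dist_eq]
    simpa [hδ] using hw
  have hT : ∀ x c, (x, c) ∈ N → (P (SQ (Q (x, c)))).2 = x + A (x, c) := fun x c hxc => by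
    rw [hSQinv _ hxc.2]
  refine ⟨δ, hδ, {y | ((0 : W), y) ∈ P '' N} ∩ G ⁻¹' Metric.ball 0 δ, ?_, ?_,
    fun p => (P (SQ p)).2, fun y => (SP (0, y)).1, Q '' N, hQN, hball, ?_, ?_, ?_, ?_, ?_⟩
  · exact (hPN.preimage (by fun_prop : Continuous fun y : V => ((0 : W), y))).inter
      (Metric.isOpen_ball.preimage hG.continuous)
  · intro x hx
    refine ⟨⟨(x, 0), hNC ⟨hx, rfl⟩, hP0 x hx⟩, ?_⟩
    have : G x = 0 := hx
    simpa [this] using hδ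
  · exact (contDiff_snd.comp hPs).comp_contDiffOn
      (hSQ.mono (Set.image_mono Set.inter_subset_right))
  · refine contDiff_fst.comp_contDiffOn (hSP.comp (t := P '' NP)
      (contDiff_const.prodMk contDiff_id).contDiffOn ?_)
    rintro y ⟨⟨p, hp, hpy⟩, -⟩
    exact ⟨p, hp.1, hpy⟩
  · intro x hx
    have := hT x 0 (hNC ⟨hx, rfl⟩)
    rwa [hQ0 x hx, hA0, add_zero] at this
  · intro x hx w hw
    obtain ⟨⟨a, c⟩, hac, hq⟩ := hball (show (x, w) ∈ K ×ˢ Metric.ball (0 : W) δ from ⟨hx, hw⟩)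
    obtain rfl : a = x := (Prod.ext_iff.1 hq).1
    have hGw : G (a + A (a, c)) = w := (Prod.ext_iff.1 hq).2
    have hTx := hT a c hac
    rw [hq] at hTx
    simp only [hTx]
    have hPy : P (a, c) = (0, a + A (a, c)) := by simp [hP, hx]
    refine ⟨⟨⟨(a, c), hac, hPy⟩, ?_⟩, hGw, ?_⟩
    · change G (a + A (a, c)) ∈ Metric.ball 0 δ
      rwa [hGw]
    · rw [← hPy, hSPinv _ hac.1]
  · rintro y ⟨⟨⟨x, c⟩, hxc, hp⟩, hy⟩
    obtain ⟨hx, rfl⟩ := Prod.ext_iff.1 hp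
    have hπ : (SP (0, (P (x, c)).2)).1 = x := by
      rw [show ((0 : W), (P (x, c)).2) = P (x, c) from Prod.ext hx.symm rfl, hSPinv _ hxc.1]
    refine ⟨hy, ?_, ?_⟩
    · simp only [hπ]; exact hx
    · simp only [hπ]
      exact hT x c hxc

end Tubular

/-! ### The mixed function -/

section MixedFunction

variable {n : ℕ}

/-- The chain rule for polynomials in differentiable functions. -/
lemma hasFDerivAt_eval {V : Type*} [NormedAddCommGroup V] [NormedSpace ℝ V]
    {φ : Fin n → V → ℂ} {φ' : Fin n → V →L[ℝ] ℂ} {x : V}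
    (hφ : ∀ j, HasFDerivAt (φ j) (φ' j) x) (f : MvPolynomial (Fin n) ℂ) :
    HasFDerivAt (fun w => MvPolynomial.eval (fun j => φ j w) f)
      (∑ j, MvPolynomial.eval (fun j => φ j x) (MvPolynomial.pderiv j f) • φ' j) x := by
  induction f using MvPolynomial.induction_on with
  | C c =>
    refine HasFDerivAt.congr_fderiv ((hasFDerivAt_const (𝕜 := ℝ) c x).congr_of_eventuallyEq
      (Filter.Eventually.of_forall fun w => by simp)) ?_
    ext v
    simp
  | add p q hp hq =>
    refine HasFDerivAt.congr_fderiv ((hp.add hq).congr_of_eventuallyEq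
      (Filter.Eventually.of_forall fun w => by simp)) ?_
    ext v
    simp only [add_apply, sum_apply, smul_apply, map_add, smul_eq_mul, add_mul,
      Finset.sum_add_distrib]
  | mul_X p i hp =>
    refine HasFDerivAt.congr_fderiv ((hp.mul (hφ i)).congr_of_eventuallyEq
      (Filter.Eventually.of_forall fun w => by simp)) ?_
    ext v
    have : ∀ j, MvPolynomial.eval (fun j => φ j x) (MvPolynomial.pderiv j (p * MvPolynomial.X i)) *
        φ' j v = (if j = i then MvPolynomial.eval (fun j => φ j x) p * φ' i v else 0) +
        φ i x * (MvPolynomial.eval (fun j => φ j x) (MvPolynomial.pderiv j p) * φ' j v) := by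
      intro j
      rw [Derivation.leibniz, MvPolynomial.pderiv_X]
      by_cases h : j = i
      · subst h
        simp
        ring
      · simp [h, Ne.symm h]
        ring
    simp only [add_apply, sum_apply, smul_apply, smul_eq_mul, this, Finset.sum_add_distrib,
      ← Finset.mul_sum]
    simp

/-- The coordinate `z_j` as a real linear functional. -/
def coordCLM (j : Fin n) : Cn n →L[ℝ] ℂ :=
  (EuclideanSpace.proj j : Cn n →L[ℂ] ℂ).restrictScalars ℝ

lemma hasFDerivAt_mixedMonomial (a b : ℕ) (j : Fin n) (w : Cn n) :
    HasFDerivAt (fun w : Cn n => w j ^ a * conj (w j) ^ b)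
      ((a * w j ^ (a - 1) * conj (w j) ^ b) • coordCLM j +
        (w j ^ a * (b * conj (w j) ^ (b - 1))) • (Complex.conjCLE : ℂ →L[ℝ] ℂ) ∘L coordCLM j) w := by
  have h1 : HasFDerivAt (fun w : Cn n => w j) (coordCLM j) w := (coordCLM j).hasFDerivAt
  have h2 : HasFDerivAt (fun w : Cn n => conj (w j))
      ((Complex.conjCLE : ℂ →L[ℝ] ℂ) ∘L coordCLM j) w :=
    ((Complex.conjCLE : ℂ →L[ℝ] ℂ) ∘L coordCLM j).hasFDerivAt
  refine HasFDerivAt.congr_fderiv ((h1.pow a).mul (h2.pow b)) ?_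
  ext v
  simp
  ring

lemma contDiff_mixedPullback (a b : ℕ) (f : MvPolynomial (Fin n) ℂ) :
    ContDiff ℝ ∞ (mixedPullback a b f) := by
  have h1 : ∀ j : Fin n, ContDiff ℝ ∞ (fun w : Cn n => w j) := fun j => (coordCLM j).contDiff
  have h2 : ∀ j : Fin n, ContDiff ℝ ∞ (fun w : Cn n => conj (w j)) := fun j =>
    ((Complex.conjCLE : ℂ →L[ℝ] ℂ) ∘L coordCLM j).contDiff
  unfold mixedPullback
  simp only [MvPolynomial.eval_eq]
  exact ContDiff.sum fun ν _ => contDiff_const.mul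
    (contDiff_prod fun j _ => (((h1 j).pow a).mul ((h2 j).pow b)).pow _)

/-- The complex linear and antilinear parts of the derivative of the mixed function. -/
lemma fderiv_mixedPullback (a b : ℕ) (f : MvPolynomial (Fin n) ℂ) (w v : Cn n) :
    fderiv ℝ (mixedPullback a b f) w v = ∑ j,
      ((MvPolynomial.eval (fun j => w j ^ a * conj (w j) ^ b) (MvPolynomial.pderiv j f) *
        (a * w j ^ (a - 1) * conj (w j) ^ b)) * v j +
      (MvPolynomial.eval (fun j => w j ^ a * conj (w j) ^ b) (MvPolynomial.pderiv j f) *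
        (w j ^ a * (b * conj (w j) ^ (b - 1)))) * conj (v j)) := by
  have h : HasFDerivAt (mixedPullback a b f) _ w :=
    hasFDerivAt_eval (fun j => hasFDerivAt_mixedMonomial a b j w) f
  rw [h.fderiv, sum_apply]
  refine Finset.sum_congr rfl fun j _ => ?_
  simp [coordCLM]
  ring

/-- A real linear map whose complex linear part dominates its antilinear part has symplectic
kernel. -/
lemma exists_isSymplecticPair {L : Cn n →ₗ[ℝ] ℂ} (A B : Fin n → ℂ)
    (hL : ∀ v, L v = ∑ j, (A j * v j + B j * conj (v j)))
    (hAB : 0 < ∑ j, (Complex.normSq (A j) - Complex.normSq (B j))) :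
    ∃ ξ₁ ξ₂, IsSymplecticPair L ξ₁ ξ₂ := by
  -- Since `Re L(v) = Re ∑ (A_j + conj B_j) v_j` and `Im L(v) = Im ∑ (A_j - conj B_j) v_j`, these
  -- are the duals of `Re L` and `Im L` for `4 Im ⟨·,·⟩`. Then `Re L(ξ₂) = ∑ (|A_j|² - |B_j|²) / 4`.
  refine ⟨WithLp.toLp 2 fun j => -(Complex.I / 4) * conj (A j + conj (B j)),
    WithLp.toLp 2 fun j => conj (A j - conj (B j)) / 4, ?_, ?_, ?_⟩
  · intro v
    rw [hL, PiLp.inner_apply, Complex.im_sum, Complex.re_sum, Finset.mul_sum]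
    refine Finset.sum_congr rfl fun j _ => ?_
    simp [Complex.add_re, Complex.mul_re, Complex.mul_im, Complex.div_re, Complex.div_im]
    ring
  · intro v
    rw [hL, PiLp.inner_apply, Complex.im_sum, Complex.im_sum, Finset.mul_sum]
    refine Finset.sum_congr rfl fun j _ => ?_
    simp [Complex.mul_im, Complex.div_re, Complex.div_im]
    ring
  · rw [hL, Complex.re_sum]
    have : ∑ j, (Complex.normSq (A j) - Complex.normSq (B j)) / 4 > 0 := by
      rw [← Finset.sum_div]; positivity
    refine lt_of_lt_of_eq this (Finset.sum_congr rfl fun j _ => ?_)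
    simp [Complex.add_re, Complex.mul_re, Complex.div_re, Complex.div_im,
      Complex.normSq_apply]
    ring

/-! ### Homogeneity -/

lemma mixedPullback_smul {a b d : ℕ} {f : MvPolynomial (Fin n) ℂ} (hf : f.IsHomogeneous d) (c : ℂ)
    (w : Cn n) : mixedPullback a b f (c • w) = (c ^ a * conj c ^ b) ^ d * mixedPullback a b f w := by
  unfold mixedPullback
  have : (fun j => (c • w) j ^ a * conj ((c • w) j) ^ b) =
      fun j => (c ^ a * conj c ^ b) * (w j ^ a * conj (w j) ^ b) := by
    ext j
    simp only [PiLp.smul_apply, smul_eq_mul, map_mul]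
    ring
  rw [this, MvPolynomial.eval_eq, MvPolynomial.eval_eq, Finset.mul_sum]
  refine Finset.sum_congr rfl fun ν hν => ?_
  have hd : ∑ i ∈ ν.support, ν i = d := by
    have := hf (MvPolynomial.mem_support_iff.1 hν)
    rw [Finsupp.weight_apply, Finsupp.sum] at this
    simpa using this
  simp only [mul_pow _ _ (ν _), Finset.prod_mul_distrib, Finset.prod_pow_eq_pow_sum, hd]
  ring

lemma exp_pow_mul_conj (a b d : ℕ) (μ : ℂ) (t : ℝ) :
    (Complex.exp (t * μ) ^ a * conj (Complex.exp (t * μ)) ^ b) ^ d =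
      Complex.exp (t * (d * (a * μ + b * conj μ))) := by
  rw [← Complex.exp_conj, ← Complex.exp_nat_mul, ← Complex.exp_nat_mul, ← Complex.exp_add,
    ← Complex.exp_nat_mul]
  congr 1
  simp
  ring

/-- One curve serves both symmetries: `μ = i` is rotation and `μ = 1` is dilation. -/
lemma hasDerivAt_exp_smul (μ : ℂ) (z : Cn n) :
    HasDerivAt (fun t : ℝ => Complex.exp (t * μ) • z) (μ • z) 0 := by
  have h1 : HasDerivAt (fun t : ℝ => (t : ℂ) * μ) μ 0 := by
    simpa using (Complex.ofRealCLM.hasDerivAt (x := (0 : ℝ))).mul_const μ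
  have h2 := h1.cexp.smul_const z
  simpa using h2

/-- Euler's identity, from differentiating `g(e^{tμ} z)` at `t = 0`. -/
lemma fderiv_mixedPullback_smul {a b d : ℕ} {f : MvPolynomial (Fin n) ℂ} (hf : f.IsHomogeneous d)
    (μ : ℂ) (z : Cn n) : fderiv ℝ (mixedPullback a b f) z (μ • z) =
      d * (a * μ + b * conj μ) * mixedPullback a b f z := by
  have hg : HasFDerivAt (mixedPullback a b f) (fderiv ℝ (mixedPullback a b f) z)
      (Complex.exp ((0 : ℝ) * μ) • z) := by
    simpa using ((contDiff_mixedPullback a b f).differentiable (by simp) z).hasFDerivAt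
  have h1 := hg.comp_hasDerivAt 0 (hasDerivAt_exp_smul μ z)
  have h2 : HasDerivAt (fun t : ℝ => Complex.exp (t * (d * (a * μ + b * conj μ))) *
      mixedPullback a b f z) (d * (a * μ + b * conj μ) * mixedPullback a b f z) 0 := by
    have h3 : HasDerivAt (fun t : ℝ => (t : ℂ) * (d * (a * μ + b * conj μ)))
        (d * (a * μ + b * conj μ)) 0 := by
      simpa using (Complex.ofRealCLM.hasDerivAt (x := (0 : ℝ))).mul_const _
    simpa using h3.cexp.mul_const (mixedPullback a b f z)
  refine h1.unique (h2.congr_of_eventuallyEq (Filter.Eventually.of_forall fun t => ?_))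
  simp only [Function.comp_apply, mixedPullback_smul hf, exp_pow_mul_conj]

/-! ### Non-degeneracy -/

/-- Non-degeneracy speaks only of points of the torus, so `y` is moved there. With weight `1` on its
non-zero coordinates and `2` on the others, the face function is the part of `f` involving only the
former variables. It is unchanged if the zero coordinates of `y` are replaced by `1`, and a variable
in which its derivative is non-zero must be one with `y j ≠ 0`. -/
lemma exists_pderiv_ne_zero {d : ℕ} {f : MvPolynomial (Fin n) ℂ} (hf : f.IsHomogeneous d)
    (hconv : IsConvenient f) (hnd : IsNonDegenerate f) {y : Fin n → ℂ} (hy : y ≠ 0)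
    (hy0 : MvPolynomial.eval y f = 0) :
    ∃ j, y j ≠ 0 ∧ MvPolynomial.eval y (MvPolynomial.pderiv j f) ≠ 0 := by
  classical
  set P : Fin n → ℕ := fun j => if y j = 0 then 2 else 1 with hP
  have hsum : ∀ ν ∈ f.support, ∑ j, ν j = d := by
    intro ν hν
    have := hf (MvPolynomial.mem_support_iff.1 hν)
    rw [Finsupp.weight_apply, Finsupp.sum_fintype _ _ (by simp)] at this
    simpa using this
  have hweight : ∀ ν : Fin n →₀ ℕ, Finsupp.weight P ν =
      ∑ j, ν j + ∑ j, (if y j = 0 then ν j else 0) := by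
    intro ν
    rw [Finsupp.weight_apply, Finsupp.sum_fintype _ _ (by simp), ← Finset.sum_add_distrib]
    refine Finset.sum_congr rfl fun j _ => ?_
    simp only [hP, smul_eq_mul]
    split_ifs <;> ring
  have hiff : ∀ ν ∈ f.support, Finsupp.weight P ν = d ↔ ∀ j, y j = 0 → ν j = 0 := by
    intro ν hν
    rw [hweight, hsum ν hν, Nat.add_eq_left, Finset.sum_eq_zero_iff]
    simp
  obtain ⟨j₀, hj₀⟩ : ∃ j, y j ≠ 0 := by
    by_contra h
    push Not at h
    exact hy (funext h)
  have hleast : IsLeast {e' | ∃ ν ∈ f.support, Finsupp.weight P ν = e'} d := by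
    refine ⟨?_, ?_⟩
    -- Convenience ensures that the least weight is really `d`: a pure power of a non-vanishing
    -- coordinate attains it.
    · obtain ⟨e, he, hc⟩ := hconv j₀
      refine ⟨Finsupp.single j₀ e, MvPolynomial.mem_support_iff.2 hc,
        (hiff _ (MvPolynomial.mem_support_iff.2 hc)).2 fun j hj => ?_⟩
      rw [Finsupp.single_apply, if_neg]
      rintro rfl
      exact hj₀ hj
    · rintro e ⟨ν, hν, rfl⟩
      rw [hweight, hsum ν hν]
      exact Nat.le_add_right _ _
  set y' : Fin n → ℂ := fun j => if y j = 0 then 1 else y j with hy'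
  have hcomp : MvPolynomial.weightedHomogeneousComponent P d f =
      ∑ ν ∈ f.support with Finsupp.weight P ν = d, MvPolynomial.monomial ν (f.coeff ν) :=
    MvPolynomial.weightedHomogeneousComponent_apply _ _
  have hprod : ∀ ν : Fin n →₀ ℕ, (∀ j, y j = 0 → ν j = 0) →
      (ν.prod fun j e => y' j ^ e) = ν.prod fun j e => y j ^ e := by
    intro ν hν
    refine Finsupp.prod_congr fun j hj => ?_
    rw [hy']
    simp only
    rw [if_neg fun h => (Finsupp.mem_support_iff.1 hj) (hν j h)]
  have hprod0 : ∀ ν : Fin n →₀ ℕ, (∃ j, y j = 0 ∧ ν j ≠ 0) →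
      (ν.prod fun j e => y j ^ e) = 0 := by
    rintro ν ⟨j, hj, hνj⟩
    refine Finset.prod_eq_zero (Finsupp.mem_support_iff.2 hνj) ?_
    simp only [hj, zero_pow hνj]
  have heval : MvPolynomial.eval y' (MvPolynomial.weightedHomogeneousComponent P d f) =
      MvPolynomial.eval y f := by
    conv_rhs => rw [f.as_sum]
    rw [hcomp, map_sum, map_sum]
    simp only [MvPolynomial.eval_monomial]
    rw [← Finset.sum_filter_of_ne (s := f.support) (p := fun ν => Finsupp.weight P ν = d)]
    · refine Finset.sum_congr rfl fun ν hν => ?_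
      obtain ⟨hν, hw⟩ := Finset.mem_filter.1 hν
      rw [hprod ν ((hiff ν hν).1 hw)]
    · intro ν hν hne
      rw [hiff ν hν]
      by_contra h
      push Not at h
      exact hne (by rw [hprod0 ν h, mul_zero])
  have hderiv : ∀ j, y j ≠ 0 → MvPolynomial.eval y' (MvPolynomial.pderiv j
      (MvPolynomial.weightedHomogeneousComponent P d f)) =
      MvPolynomial.eval y (MvPolynomial.pderiv j f) := by
    intro j hj
    conv_rhs => rw [f.as_sum]
    rw [hcomp, map_sum, map_sum, map_sum, map_sum]
    simp only [MvPolynomial.pderiv_monomial, MvPolynomial.eval_monomial]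
    rw [← Finset.sum_filter_of_ne (s := f.support) (p := fun ν => Finsupp.weight P ν = d)]
    · refine Finset.sum_congr rfl fun ν hν => ?_
      obtain ⟨hν, hw⟩ := Finset.mem_filter.1 hν
      rw [hprod]
      intro i hi
      rw [Finsupp.tsub_apply, (hiff ν hν).1 hw i hi, Nat.zero_sub]
    · intro ν hν hne
      rw [hiff ν hν]
      by_contra h
      push Not at h
      obtain ⟨i, hi, hνi⟩ := h
      refine hne ?_
      rw [hprod0 _ ⟨i, hi, ?_⟩, mul_zero]
      have hij : j ≠ i := by rintro rfl; exact hj hi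
      rwa [Finsupp.tsub_apply, Finsupp.single_eq_of_ne hij.symm, Nat.sub_zero]
  have hderiv0 : ∀ j, y j = 0 → MvPolynomial.eval y' (MvPolynomial.pderiv j
      (MvPolynomial.weightedHomogeneousComponent P d f)) = 0 := by
    intro j hj
    rw [hcomp, map_sum, map_sum]
    refine Finset.sum_eq_zero fun ν hν => ?_
    obtain ⟨hν, hw⟩ := Finset.mem_filter.1 hν
    rw [MvPolynomial.pderiv_monomial, (hiff ν hν).1 hw j hj]
    simp
  obtain ⟨j, hj⟩ := hnd P (fun j => by simp only [hP]; split_ifs <;> norm_num) d hleast y'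
    (fun j => by simp only [hy']; split_ifs <;> simp_all) (heval.trans hy0)
  have hyj : y j ≠ 0 := fun h => hj (hderiv0 j h)
  exact ⟨j, hyj, hderiv j hyj ▸ hj⟩

/-- The kernel of the derivative of the mixed function is symplectic at the points of its zero set
other than the origin. -/
lemma exists_isSymplecticPair_mixedPullback {a b d : ℕ} (hab : b < a) {f : MvPolynomial (Fin n) ℂ}
    (hf : f.IsHomogeneous d) (hconv : IsConvenient f) (hnd : IsNonDegenerate f) {w : Cn n}
    (hw : w ≠ 0) (hw0 : mixedPullback a b f w = 0) :
    ∃ ξ₁ ξ₂, IsSymplecticPair (fderiv ℝ (mixedPullback a b f) w : Cn n →ₗ[ℝ] ℂ) ξ₁ ξ₂ := by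
  refine exists_isSymplecticPair _ _ (fderiv_mixedPullback a b f w) ?_
  set y : Fin n → ℂ := fun j => w j ^ a * conj (w j) ^ b with hy
  have ha : a ≠ 0 := by omega
  have hyw : ∀ j, w j ≠ 0 → y j ≠ 0 := fun j hj =>
    mul_ne_zero (pow_ne_zero _ hj) (pow_ne_zero _ ((map_ne_zero _).2 hj))
  have hterm : ∀ j, Complex.normSq (MvPolynomial.eval y (MvPolynomial.pderiv j f) *
        (a * w j ^ (a - 1) * conj (w j) ^ b)) -
      Complex.normSq (MvPolynomial.eval y (MvPolynomial.pderiv j f) *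
        (w j ^ a * (b * conj (w j) ^ (b - 1)))) =
      ((a : ℝ) ^ 2 - (b : ℝ) ^ 2) * (Complex.normSq (MvPolynomial.eval y (MvPolynomial.pderiv j f)) *
        Complex.normSq (w j) ^ (a + b - 1)) := by
    intro j
    simp only [map_mul, map_pow, Complex.normSq_conj, Complex.normSq_natCast]
    rcases Nat.eq_zero_or_pos b with rfl | hb
    -- For `b = 0` the antiholomorphic part vanishes; the case is separate because `b - 1` is
    -- truncated.
    · simp
      ring
    · rw [show a + b - 1 = a - 1 + b by omega, pow_add]
      have : Complex.normSq (w j) ^ a * Complex.normSq (w j) ^ (b - 1) =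
          Complex.normSq (w j) ^ (a - 1) * Complex.normSq (w j) ^ b := by
        rw [← pow_add, ← pow_add]
        congr 1
        omega
      linear_combination (-(b : ℝ) ^ 2 *
        Complex.normSq (MvPolynomial.eval y (MvPolynomial.pderiv j f))) * this
  rw [Finset.sum_congr rfl fun j _ => hterm j]
  have hab' : 0 < (a : ℝ) ^ 2 - (b : ℝ) ^ 2 := by
    have : (b : ℝ) < a := by exact_mod_cast hab
    have hb : (0 : ℝ) ≤ b := by positivity
    nlinarith
  obtain ⟨i, hi⟩ : ∃ j, w j ≠ 0 := by
    by_contra h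
    push Not at h
    exact hw (by ext j; simpa using h j)
  obtain ⟨j, hj, hfj⟩ := exists_pderiv_ne_zero hf hconv hnd
    (y := y) (fun h => hyw i hi (congrFun h i)) hw0
  have hwj : w j ≠ 0 := by
    intro h
    exact hj (by simp [hy, h, ha])
  have hnn : ∀ z : ℂ, 0 ≤ Complex.normSq z := Complex.normSq_nonneg
  refine Finset.sum_pos' (fun i _ => ?_) ⟨j, Finset.mem_univ _, ?_⟩
  · exact mul_nonneg hab'.le (mul_nonneg (hnn _) (pow_nonneg (hnn _) _))
  · exact mul_pos hab' (mul_pos (Complex.normSq_pos.2 hfj) (pow_pos (Complex.normSq_pos.2 hwj) _))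

end MixedFunction

/-! ### Tangent vectors -/

section Tangent

open scoped Topology

lemma tangentVectors_mono {V : Type*} [NormedAddCommGroup V] [NormedSpace ℝ V] {X Y : Set V}
    (h : X ⊆ Y) (x : V) : tangentVectors X x ⊆ tangentVectors Y x := by
  rintro v ⟨γ, ε, hε, hγ, hX, h0, hv⟩
  exact ⟨γ, ε, hε, hγ, fun t ht => h (hX t ht), h0, hv⟩

/-- A tangent vector is the velocity of a curve that is differentiable at the base point. -/
lemma exists_hasDerivAt_of_mem_tangentVectors {V : Type*} [NormedAddCommGroup V] [NormedSpace ℝ V]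
    {X : Set V} {x v : V} (hv : v ∈ tangentVectors X x) :
    ∃ γ : ℝ → V, HasDerivAt γ v 0 ∧ γ 0 = x ∧ ∀ᶠ t in 𝓝 (0 : ℝ), γ t ∈ X := by
  obtain ⟨γ, ε, hε, hγ, hX, h0, rfl⟩ := hv
  have hmem : Set.Ioo (-ε) ε ∈ 𝓝 (0 : ℝ) := Ioo_mem_nhds (by linarith) hε
  exact ⟨γ, ((hγ.contDiffAt hmem).differentiableAt (by simp)).hasDerivAt, h0,
    Filter.eventually_of_mem hmem hX⟩

lemma fderiv_eq_zero_of_mem_tangentVectors {V W : Type*} [NormedAddCommGroup V] [NormedSpace ℝ V]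
    [NormedAddCommGroup W] [NormedSpace ℝ W] {F : V → W} {X : Set V} {x v : V}
    (hF : DifferentiableAt ℝ F x) (hX : ∀ y ∈ X, F y = F x) (hv : v ∈ tangentVectors X x) :
    fderiv ℝ F x v = 0 := by
  obtain ⟨γ, hγ, rfl, hmem⟩ := exists_hasDerivAt_of_mem_tangentVectors hv
  have h1 := hF.hasFDerivAt.comp_hasDerivAt 0 hγ
  have h2 : HasDerivAt (F ∘ γ) (0 : W) 0 :=
    (hasDerivAt_const (0 : ℝ) (F (γ 0))).congr_of_eventuallyEq
      (hmem.mono fun t ht => hX _ ht)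
  exact h1.unique h2

variable {n : ℕ}

lemma fderiv_norm_sq (x v : Cn n) : fderiv ℝ (fun z : Cn n => ‖z‖ ^ 2) x v =
    2 * (inner ℂ x v).re := by
  rw [(hasStrictFDerivAt_norm_sq x).hasFDerivAt.fderiv]
  simp [PiLp.inner_apply]

lemma contDiff_norm_sq : ContDiff ℝ ∞ (fun z : Cn n => ‖z‖ ^ 2) := by
  have : ContDiff ℝ ∞ (fun z : Cn n => ‖z‖ ^ 2) := contDiff_id.norm_sq ℝ
  exact this

lemma inner_re_of_mem_tangentVectors_sphere {r : ℝ} {z v : Cn n} (hz : ‖z‖ = r)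
    (hv : v ∈ tangentVectors (Metric.sphere 0 r) z) : (inner ℂ z v).re = 0 := by
  have h := fderiv_eq_zero_of_mem_tangentVectors
    (contDiff_norm_sq.differentiable (by simp) z) (fun y hy => ?_) hv
  · rw [fderiv_norm_sq] at h
    linarith
  · rw [mem_sphere_zero_iff_norm.1 hy, hz]

/-- The central projection to the sphere of a line tangent to it. -/
def sphereCurve (r : ℝ) (z v : Cn n) (t : ℝ) : Cn n :=
  (r / √(r ^ 2 + t ^ 2 * ‖v‖ ^ 2)) • (z + t • v)

lemma contDiff_sphereCurve {r : ℝ} (hr : 0 < r) (z v : Cn n) : ContDiff ℝ ∞ (sphereCurve r z v) := by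
  have hpos : ∀ t : ℝ, 0 < r ^ 2 + t ^ 2 * ‖v‖ ^ 2 := fun t => by positivity
  unfold sphereCurve
  refine ContDiff.smul (contDiff_const.div (ContDiff.sqrt ?_ fun t => (hpos t).ne')
    fun t => (Real.sqrt_pos.2 (hpos t)).ne') ?_
  · exact contDiff_const.add ((contDiff_id.pow 2).mul contDiff_const)
  · exact contDiff_const.add (contDiff_id.smul contDiff_const)

lemma sphereCurve_zero {r : ℝ} (hr : 0 < r) (z v : Cn n) : sphereCurve r z v 0 = z := by
  simp [sphereCurve, Real.sqrt_sq hr.le, hr.ne']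

lemma norm_sphereCurve {r : ℝ} (hr : 0 < r) {z v : Cn n} (hz : ‖z‖ = r)
    (hv : (inner ℂ z v).re = 0) (t : ℝ) : ‖sphereCurve r z v t‖ = r := by
  have hpos : 0 < r ^ 2 + t ^ 2 * ‖v‖ ^ 2 := by positivity
  have h1 : ‖z + t • v‖ ^ 2 = r ^ 2 + t ^ 2 * ‖v‖ ^ 2 := by
    have h2 : (inner ℂ z (t • v)).re = 0 := by
      rw [show t • v = (t : ℂ) • v from rfl, inner_smul_right]
      simp [hv]
    have h3 := norm_add_sq (𝕜 := ℂ) z (t • v)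
    simp only [RCLike.re_to_complex, h2, norm_smul, Real.norm_eq_abs, mul_pow, sq_abs, hz] at h3
    linarith
  have h4 : ‖z + t • v‖ = √(r ^ 2 + t ^ 2 * ‖v‖ ^ 2) := by
    rw [← h1, Real.sqrt_sq (norm_nonneg _)]
  rw [sphereCurve, norm_smul, h4, Real.norm_of_nonneg (by positivity),
    div_mul_cancel₀ _ (Real.sqrt_pos.2 hpos).ne']

lemma hasDerivAt_sphereCurve {r : ℝ} (hr : 0 < r) (z v : Cn n) :
    HasDerivAt (sphereCurve r z v) v 0 := by
  have h0 : HasDerivAt (fun t : ℝ => r ^ 2 + t ^ 2 * ‖v‖ ^ 2) 0 0 := by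
    simpa using (((hasDerivAt_id (0 : ℝ)).pow 2).mul_const (‖v‖ ^ 2)).const_add (r ^ 2)
  have h1 : HasDerivAt (fun t : ℝ => r / √(r ^ 2 + t ^ 2 * ‖v‖ ^ 2)) 0 0 := by
    have hne : r ^ 2 + (0 : ℝ) ^ 2 * ‖v‖ ^ 2 ≠ 0 := by simpa using hr.ne'
    have := (hasDerivAt_const (0 : ℝ) r).div (h0.sqrt hne) 
      (by simpa [Real.sqrt_sq hr.le] using hr.ne')
    exact this.congr_deriv (by simp)
  have h2 : HasDerivAt (fun t : ℝ => z + t • v) v 0 := by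
    simpa using ((hasDerivAt_id (0 : ℝ)).smul_const v).const_add z
  exact (h1.smul h2).congr_deriv (by simp [Real.sqrt_sq hr.le, hr.ne'])

/-- The tangent space of the sphere. -/
lemma mem_tangentVectors_sphere {r : ℝ} (hr : 0 < r) {z v : Cn n} (hz : ‖z‖ = r) :
    v ∈ tangentVectors (Metric.sphere 0 r) z ↔ (inner ℂ z v).re = 0 :=
  ⟨inner_re_of_mem_tangentVectors_sphere hz, fun hv => ⟨sphereCurve r z v, 1, one_pos,
    (contDiff_sphereCurve hr z v).contDiffOn,
    fun t _ => mem_sphere_zero_iff_norm.2 (norm_sphereCurve hr hz hv t), sphereCurve_zero hr z v,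
    (hasDerivAt_sphereCurve hr z v).deriv⟩⟩

end Tangent

/-! ### The Milnor map -/

section MilnorMap

open scoped Topology

variable {n : ℕ} {g : Cn n → ℂ}

lemma contDiffAt_milnorMap (hg : ContDiff ℝ ∞ g) {z : Cn n} (hz : g z ≠ 0) :
    ContDiffAt ℝ ∞ (milnorMap g) z := by
  have h1 : ContDiffAt ℝ ∞ (fun z => ‖g z‖) z := hg.contDiffAt.norm ℝ hz
  have h2 : ContDiffAt ℝ ∞ (fun z => ((‖g z‖ : ℝ) : ℂ)) z :=
    Complex.ofRealCLM.contDiff.contDiffAt.comp z h1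
  have h3 := hg.contDiffAt.mul (h2.inv (by simpa using hz))
  exact h3.congr_of_eventuallyEq (Filter.Eventually.of_forall fun w => div_eq_mul_inv _ _)

lemma norm_milnorMap {z : Cn n} (hz : g z ≠ 0) : ‖milnorMap g z‖ = 1 := by
  rw [milnorMap, norm_div, Complex.norm_real, norm_norm, div_self (norm_ne_zero_iff.2 hz)]

lemma mul_conj_of_norm_eq_one {η : ℂ} (h : ‖η‖ = 1) : η * conj η = 1 := by
  rw [Complex.mul_conj, Complex.normSq_eq_norm_sq, h]; simp

lemma conj_mul_of_norm_eq_one {η : ℂ} (h : ‖η‖ = 1) : conj η * η = 1 := by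
  rw [mul_comm, mul_conj_of_norm_eq_one h]

/-- `g` is equivariant for the circle action with weight `N` and homogeneous for positive
dilations. -/
structure IsPolarHomogeneous (g : Cn n → ℂ) (N : ℝ) : Prop where
  contDiff : ContDiff ℝ ∞ g
  rotate : ∀ (t : ℝ) (z : Cn n), g (Complex.exp (t * Complex.I) • z) =
    Complex.exp ((N * t : ℝ) * Complex.I) * g z
  dilate : ∀ (t : ℝ) (z : Cn n), ∃ s : ℝ, 0 < s ∧ g (Complex.exp t • z) = s * g z
  pos : 0 < N
  radial : ∀ z, g z = 0 → fderiv ℝ g z z = 0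

/-- A factor `c` acts on each argument of `f` by `c^a conj(c)^b`: the phase is multiplied by `a -
b`, the logarithm of the modulus by `a + b`. -/
lemma isPolarHomogeneous_mixedPullback {a b d : ℕ} (hab : b < a) (hd : 0 < d)
    {f : MvPolynomial (Fin n) ℂ} (hf : f.IsHomogeneous d) :
    IsPolarHomogeneous (mixedPullback a b f) (d * (a - b)) where
  contDiff := contDiff_mixedPullback a b f
  rotate t z := by
    rw [mixedPullback_smul hf, exp_pow_mul_conj]
    congr 2
    simp
    ring
  dilate t z := by
    refine ⟨Real.exp (t * (d * (a + b))), Real.exp_pos _, ?_⟩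
    have := exp_pow_mul_conj a b d 1 t
    rw [mul_one] at this
    rw [mixedPullback_smul hf, this]
    simp
  pos := by
    have : (b : ℝ) < a := by exact_mod_cast hab
    have : (0 : ℝ) < d := by exact_mod_cast hd
    have : (0 : ℝ) < a - b := by linarith
    positivity
  radial z hz := by
    have := fderiv_mixedPullback_smul hf 1 z (a := a) (b := b)
    rw [one_smul, hz, mul_zero] at this
    exact this

namespace IsPolarHomogeneous

variable {N : ℝ} (h : IsPolarHomogeneous g N)
include h

lemma rotate_ne_zero (t : ℝ) {z : Cn n} (hz : g z ≠ 0) :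
    g (Complex.exp (t * Complex.I) • z) ≠ 0 := by
  rw [h.rotate]
  exact mul_ne_zero (Complex.exp_ne_zero _) hz

lemma milnorMap_rotate (t : ℝ) (z : Cn n) : milnorMap g (Complex.exp (t * Complex.I) • z) =
    Complex.exp ((N * t : ℝ) * Complex.I) * milnorMap g z := by
  rw [milnorMap, milnorMap, h.rotate, norm_mul, Complex.norm_exp_ofReal_mul_I, one_mul, mul_div_assoc]

lemma milnorMap_dilate (t : ℝ) (z : Cn n) :
    milnorMap g (Complex.exp t • z) = milnorMap g z := by
  obtain ⟨s, hs, hg⟩ := h.dilate t z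
  have : (s : ℂ) ≠ 0 := by exact_mod_cast hs.ne'
  rw [milnorMap, milnorMap, hg, norm_mul, Complex.norm_real, Real.norm_of_nonneg hs.le]
  push_cast
  rw [mul_div_mul_left _ _ this]

lemma hasFDerivAt_milnorMap {z : Cn n} (hz : g z ≠ 0) :
    HasFDerivAt (milnorMap g) (fderiv ℝ (milnorMap g) z) z :=
  ((contDiffAt_milnorMap h.contDiff hz).differentiableAt (by simp)).hasFDerivAt

/-- `iz` generates the circle action, along which `θ` turns at speed `N`. -/
lemma dAngle_I_smul {z : Cn n} (hz : g z ≠ 0) :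
    dAngle (milnorMap g) z (Complex.I • z) = N := by
  have h1 : HasFDerivAt (milnorMap g) (fderiv ℝ (milnorMap g) z)
      (Complex.exp ((0 : ℝ) * Complex.I) • z) := by
    simpa using h.hasFDerivAt_milnorMap hz
  have h2 := h1.comp_hasDerivAt 0 (hasDerivAt_exp_smul Complex.I z)
  have h3 : HasDerivAt (fun t : ℝ => ((N * t : ℝ) : ℂ) * Complex.I) (N * Complex.I) 0 := by
    have := ((Complex.ofRealCLM.hasDerivAt (x := (0 : ℝ))).const_mul (N : ℂ)).mul_const Complex.I
    simpa using this
  have h4 := h3.cexp.mul_const (milnorMap g z)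
  have h5 := h2.unique (h4.congr_of_eventuallyEq
    (Filter.Eventually.of_forall fun t => h.milnorMap_rotate t z))
  have h6 := conj_mul_of_norm_eq_one (norm_milnorMap hz)
  rw [dAngle, h5]
  rw [show conj (milnorMap g z) * (Complex.exp (((N * (0 : ℝ) : ℝ) : ℂ) * Complex.I) *
    (N * Complex.I) * milnorMap g z) = (N * Complex.I) * (conj (milnorMap g z) * milnorMap g z) by
      simp; ring, h6]
  simp

lemma dAngle_self {z : Cn n} (hz : g z ≠ 0) : dAngle (milnorMap g) z z = 0 := by
  have h1 : HasFDerivAt (milnorMap g) (fderiv ℝ (milnorMap g) z)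
      (Complex.exp ((0 : ℝ) * 1) • z) := by
    simpa using h.hasFDerivAt_milnorMap hz
  have h2 := h1.comp_hasDerivAt 0 (hasDerivAt_exp_smul 1 z)
  have h3 := h2.unique ((hasDerivAt_const (0 : ℝ) (milnorMap g z)).congr_of_eventuallyEq
    (Filter.Eventually.of_forall fun t => by
      simpa using h.milnorMap_dilate t z))
  rw [one_smul] at h3
  rw [dAngle, h3]
  simp

end IsPolarHomogeneous

lemma mem_page {r : ℝ} {η : ℂ} {z : Cn n} :
    z ∈ page (Metric.sphere 0 r) (link g r) (milnorMap g) η ↔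
      ‖z‖ = r ∧ g z ≠ 0 ∧ milnorMap g z = η := by
  simp only [page, link, Set.mem_sdiff, Set.mem_ofPred_eq, mem_sphere_zero_iff_norm]
  tauto

lemma dAngle_of_mem_tangentVectors_page {N r : ℝ} (h : IsPolarHomogeneous g N) {η : ℂ} {z v : Cn n}
    (hz : g z ≠ 0) (hη : milnorMap g z = η)
    (hv : v ∈ tangentVectors (page (Metric.sphere 0 r) (link g r) (milnorMap g) η) z) :
    dAngle (milnorMap g) z v = 0 := by
  rw [dAngle, fderiv_eq_zero_of_mem_tangentVectors (h.hasFDerivAt_milnorMap hz).differentiableAt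
    (fun y hy => hy.2.trans hη.symm) hv]
  simp

/-- The angle from `η`, divided by `N`. -/
def relAngle (N : ℝ) (η ζ : ℂ) : ℝ := (Complex.log (ζ * conj η)).im / N

lemma contDiffAt_relAngle (N : ℝ) {η ζ : ℂ} (h : 0 < (ζ * conj η).re) :
    ContDiffAt ℝ ∞ (relAngle N η) ζ := by
  have h1 : ContDiffAt ℝ ∞ Complex.log (ζ * conj η) :=
    (Complex.contDiffAt_log (Or.inl h)).restrict_scalars ℝ
  have h2 : ContDiffAt ℝ ∞ (fun ζ : ℂ => Complex.log (ζ * conj η)) ζ :=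
    h1.comp ζ (contDiffAt_id.mul contDiffAt_const)
  exact (Complex.imCLM.contDiff.contDiffAt.comp ζ h2).div_const N

lemma exp_relAngle {N : ℝ} (hN : N ≠ 0) {η ζ : ℂ} (hη : ‖η‖ = 1) (hζ : ‖ζ‖ = 1) :
    Complex.exp ((N * relAngle N η ζ : ℝ) * Complex.I) = ζ * conj η := by
  have : N * relAngle N η ζ = (ζ * conj η).arg := by
    rw [relAngle, Complex.log_im]; field_simp
  rw [this]
  have h := Complex.norm_mul_exp_arg_mul_I (ζ * conj η)
  rwa [norm_mul, Complex.norm_conj, hη, hζ, mul_one, Complex.ofReal_one, one_mul] at h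

lemma exp_neg_relAngle {N : ℝ} (hN : N ≠ 0) {η ζ : ℂ} (hη : ‖η‖ = 1) (hζ : ‖ζ‖ = 1) :
    Complex.exp ((N * -relAngle N η ζ : ℝ) * Complex.I) * ζ = η := by
  have h := exp_relAngle hN hη hζ
  rw [show (((N * -relAngle N η ζ : ℝ) : ℂ) * Complex.I) =
    -(((N * relAngle N η ζ : ℝ) : ℂ) * Complex.I) by push_cast; ring, Complex.exp_neg, h]
  have h1 : ζ ≠ 0 := by rintro rfl; simp at hζ
  have h2 : conj η * η = 1 := conj_mul_of_norm_eq_one hη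
  rw [mul_inv, mul_comm, ← mul_assoc, mul_inv_cancel₀ h1, one_mul]
  exact inv_eq_of_mul_eq_one_right h2

lemma relAngle_self (N : ℝ) {η : ℂ} (hη : ‖η‖ = 1) : relAngle N η η = 0 := by
  rw [relAngle, mul_conj_of_norm_eq_one hη]; simp

lemma norm_exp_smul (t : ℝ) (z : Cn n) : ‖Complex.exp (t * Complex.I) • z‖ = ‖z‖ := by
  rw [norm_smul, Complex.norm_exp_ofReal_mul_I, one_mul]

/-- The tangent space of a page. -/
lemma mem_tangentVectors_page {N r : ℝ} (h : IsPolarHomogeneous g N) (hr : 0 < r) {z v : Cn n}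
    (hz : ‖z‖ = r) (hgz : g z ≠ 0) (hv : (inner ℂ z v).re = 0)
    (hθ : dAngle (milnorMap g) z v = 0) :
    v ∈ tangentVectors (page (Metric.sphere 0 r) (link g r) (milnorMap g) (milnorMap g z)) z := by
  set η := milnorMap g z with hη
  have hη1 : ‖η‖ = 1 := norm_milnorMap hgz
  set c := sphereCurve r z v
  have hc : ContDiff ℝ ∞ c := contDiff_sphereCurve hr z v
  have hc0 : c 0 = z := sphereCurve_zero hr z v
  have hc' : HasDerivAt c v 0 := hasDerivAt_sphereCurve hr z v
  have hθc : ∀ t, g (c t) ≠ 0 → ContDiffAt ℝ ∞ (fun t => milnorMap g (c t)) t := fun t ht =>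
    (contDiffAt_milnorMap h.contDiff ht).comp t hc.contDiffAt
  have hnear : ∀ᶠ t in 𝓝 (0 : ℝ), g (c t) ≠ 0 ∧ 0 < (milnorMap g (c t) * conj η).re := by
    have h1 : ContinuousAt (fun t => g (c t)) 0 :=
      (h.contDiff.continuous.comp hc.continuous).continuousAt
    have h2 : ContinuousAt (fun t => (milnorMap g (c t) * conj η).re) 0 :=
      Complex.continuous_re.continuousAt.comp
        ((hθc 0 (by rwa [hc0])).continuousAt.mul continuousAt_const)
    refine (h1.eventually_ne (by rwa [hc0])).and (h2.eventually_const_lt ?_)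
    simp only [hc0]
    rw [← hη, mul_conj_of_norm_eq_one hη1]
    simp
  obtain ⟨ε, hε, hball⟩ := Metric.eventually_nhds_iff.1 hnear
  have hI : ∀ t ∈ Set.Ioo (-ε) ε, g (c t) ≠ 0 ∧ 0 < (milnorMap g (c t) * conj η).re := fun t ht =>
    hball (by rw [Real.dist_eq, sub_zero, abs_lt]; exact ht)
  -- Rotating the curve on the sphere by `ψ` brings it back into the page. Since `ψ'(0) = -dθ(v) / N
  -- = 0`, the correction does not alter its velocity.
  set ψ : ℝ → ℝ := fun t => -relAngle N η (milnorMap g (c t)) with hψ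
  have hψs : ∀ t ∈ Set.Ioo (-ε) ε, ContDiffAt ℝ ∞ ψ t := fun t ht =>
    ((contDiffAt_relAngle N (hI t ht).2).comp t (hθc t (hI t ht).1)).neg
  have hψ0 : ψ 0 = 0 := by simp [hψ, hc0, ← hη, relAngle_self N hη1]
  have h0mem : (0 : ℝ) ∈ Set.Ioo (-ε) ε := ⟨by linarith, hε⟩
  have hψ' : HasDerivAt ψ 0 0 := by
    have h1 : HasFDerivAt (milnorMap g) (fderiv ℝ (milnorMap g) z) (c 0) := by
      rw [hc0]; exact h.hasFDerivAt_milnorMap hgz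
    have h2 := (h1.comp_hasDerivAt 0 hc').mul_const (conj η)
    have hone : (milnorMap g ∘ c) 0 * conj η = 1 := by
      rw [Function.comp_apply, hc0, ← hη, mul_conj_of_norm_eq_one hη1]
    have h3 := h2.clog_real (by rw [hone]; simp)
    have h4 := ((Complex.imCLM.hasFDerivAt.comp_hasDerivAt 0 h3).div_const N).neg
    rw [hone, div_one, Complex.imCLM_apply, mul_comm, ← dAngle, hθ, zero_div, neg_zero] at h4
    exact h4
  set e : ℝ → ℂ := fun t => Complex.exp (ψ t * Complex.I) with he
  have hes : ∀ t ∈ Set.Ioo (-ε) ε, ContDiffAt ℝ ∞ e t := fun t ht =>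
    (Complex.contDiff_exp.contDiffAt).comp t
      ((Complex.ofRealCLM.contDiff.contDiffAt.comp t (hψs t ht)).mul contDiffAt_const)
  have he' : HasDerivAt e 0 0 := by
    have := ((Complex.ofRealCLM.hasFDerivAt.comp_hasDerivAt 0 hψ').mul_const Complex.I).cexp
    simpa using this
  refine ⟨fun t => e t • c t, ε, hε, fun t ht => ((hes t ht).smul hc.contDiffAt).contDiffWithinAt,
    fun t ht => mem_page.2 ⟨?_, h.rotate_ne_zero _ (hI t ht).1, ?_⟩, ?_, ?_⟩
  · rw [norm_exp_smul, norm_sphereCurve hr hz hv]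
  · rw [h.milnorMap_rotate]
    exact exp_neg_relAngle h.pos.ne' hη1 (norm_milnorMap (hI t ht).1)
  · simp [he, hψ0, hc0]
  · have := he'.smul hc'
    rw [show (fun t => e t • c t) = e • c from rfl, this.deriv]
    simp [he, hψ0]

end MilnorMap

/-! ### The open book -/

section OpenBook

variable {n : ℕ} {g : Cn n → ℂ}

lemma fderiv_coord {V : Type*} [NormedAddCommGroup V] [NormedSpace ℝ V] {m : ℕ}
    {h : V → EuclideanSpace ℝ (Fin m)} {y : V} (hh : DifferentiableAt ℝ h y) (i : Fin m) {D : V →L[ℝ] ℝ}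
    (hD : HasFDerivAt (fun z => h z i) D y) (v : V) : fderiv ℝ h y v i = D v := by
  have h1 := ((EuclideanSpace.proj i : EuclideanSpace ℝ (Fin m) →L[ℝ] ℝ).hasFDerivAt).comp y
    hh.hasFDerivAt
  exact congrArg (fun L => L v) (h1.unique hD)

lemma isSubmanifold_sphere {r : ℝ} (hr : 0 < r) :
    IsSubmanifold 1 (Metric.sphere (0 : Cn n) r) := by
  intro x _
  set h : Cn n → EuclideanSpace ℝ (Fin 1) := fun z => WithLp.toLp 2 fun _ => ‖z‖ ^ 2 - r ^ 2 with hh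
  have hs : ContDiff ℝ ∞ h :=
    contDiff_euclidean.2 fun _ => contDiff_norm_sq.sub contDiff_const
  refine ⟨Set.univ, isOpen_univ, trivial, h, hs.contDiffOn, ?_, ?_⟩
  · ext z
    simp only [Set.inter_univ, mem_sphere_zero_iff_norm, Set.mem_univ, true_and,
      Set.mem_ofPred_eq, hh]
    refine ⟨fun hz => by ext i; simp [hz], fun hz => ?_⟩
    have := congrArg (fun w : EuclideanSpace ℝ (Fin 1) => w 0) hz
    simp only [PiLp.zero_apply, sub_eq_zero] at this
    exact (pow_left_inj₀ (norm_nonneg z) hr.le two_ne_zero).1 this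
  · rintro y ⟨hy, -⟩ c
    have hy' : ‖y‖ = r := mem_sphere_zero_iff_norm.1 hy
    have hcoord : ∀ v, fderiv ℝ h y v 0 = 2 * (inner ℂ y v).re := by
      intro v
      have h2 : HasFDerivAt (fun z : Cn n => ‖z‖ ^ 2 - r ^ 2) _ y :=
        (contDiff_norm_sq.differentiable (by simp) y).hasFDerivAt.sub_const (r ^ 2)
      rw [← fderiv_norm_sq, ← fderiv_coord (hs.differentiable (by simp) y) 0 h2]
    refine ⟨(c 0 / (2 * r ^ 2)) • y, ?_⟩
    ext i
    fin_cases i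
    have hyy : (inner ℂ y y).re = r ^ 2 := by
      rw [inner_self_eq_norm_sq_to_K, hy']
      simp [← Complex.ofReal_pow]
    simp only [map_smul, PiLp.smul_apply, Fin.zero_eta, hcoord, hyy, smul_eq_mul]
    field_simp

/-- The equations of the link in real coordinates. -/
def linkMap (g : Cn n → ℂ) (r : ℝ) (z : Cn n) : EuclideanSpace ℝ (Fin 3) :=
  WithLp.toLp 2 ![‖z‖ ^ 2 - r ^ 2, (g z).re, (g z).im]

/-- The embedding of `ℂ` in the last two real coordinates. -/
def discEmbedding (η : ℂ) : EuclideanSpace ℝ (Fin 3) := WithLp.toLp 2 ![0, η.re, η.im]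

lemma contDiff_linkMap (hg : ContDiff ℝ ∞ g) (r : ℝ) : ContDiff ℝ ∞ (linkMap g r) := by
  refine contDiff_euclidean.2 fun i => ?_
  fin_cases i
  · exact contDiff_norm_sq.sub contDiff_const
  · exact Complex.reCLM.contDiff.comp hg
  · exact Complex.imCLM.contDiff.comp hg

lemma contDiff_discEmbedding : ContDiff ℝ ∞ discEmbedding := by
  refine contDiff_euclidean.2 fun i => ?_
  fin_cases i
  · exact contDiff_const
  · exact Complex.reCLM.contDiff
  · exact Complex.imCLM.contDiff

lemma norm_discEmbedding (η : ℂ) : ‖discEmbedding η‖ = ‖η‖ := by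
  rw [EuclideanSpace.norm_eq, Complex.norm_eq_sqrt_sq_add_sq]
  simp [discEmbedding, Fin.sum_univ_three]

lemma linkMap_eq_discEmbedding {r : ℝ} (hr : 0 < r) {z : Cn n} {η : ℂ} :
    linkMap g r z = discEmbedding η ↔ ‖z‖ = r ∧ g z = η := by
  constructor
  · intro h
    have h0 := congrArg (fun w : EuclideanSpace ℝ (Fin 3) => w 0) h
    have h1 := congrArg (fun w : EuclideanSpace ℝ (Fin 3) => w 1) h
    have h2 := congrArg (fun w : EuclideanSpace ℝ (Fin 3) => w 2) h
    simp only [linkMap, discEmbedding, Matrix.cons_val, sub_eq_zero] at h0 h1 h2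
    exact ⟨(pow_left_inj₀ (norm_nonneg z) hr.le two_ne_zero).1 h0, Complex.ext h1 h2⟩
  · rintro ⟨rfl, rfl⟩
    simp [linkMap, discEmbedding]

lemma discEmbedding_zero : discEmbedding 0 = 0 := by
  ext i; fin_cases i <;> simp [discEmbedding]

lemma linkMap_eq_zero {r : ℝ} (hr : 0 < r) {z : Cn n} :
    linkMap g r z = 0 ↔ ‖z‖ = r ∧ g z = 0 := by
  rw [← discEmbedding_zero, linkMap_eq_discEmbedding hr]

lemma mem_link {r : ℝ} {z : Cn n} : z ∈ link g r ↔ ‖z‖ = r ∧ g z = 0 := by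
  simp [link]

lemma linkMap_preimage_zero {r : ℝ} (hr : 0 < r) : linkMap g r ⁻¹' {0} = link g r := by
  ext z
  rw [Set.mem_preimage, Set.mem_singleton_iff, linkMap_eq_zero hr, mem_link]

lemma isCompact_link (hg : Continuous g) (r : ℝ) : IsCompact (link g r) :=
  (isCompact_sphere (0 : Cn n) r).inter_right (isClosed_eq hg continuous_const)

/-- The radial direction adjusts `|z|²` without changing `g` to first order, and `dg` reaches the
other two coordinates. -/
lemma fderiv_linkMap_surjective (hg : ContDiff ℝ ∞ g) {r : ℝ} (hr : 0 < r) {z : Cn n}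
    (hz : ‖z‖ = r) (hrad : fderiv ℝ g z z = 0) (hsurj : Function.Surjective (fderiv ℝ g z)) :
    Function.Surjective (fderiv ℝ (linkMap g r) z) := by
  have h1 := fderiv_coord ((contDiff_linkMap hg r).differentiable (by simp) z)
  have hg' := (hg.differentiable (by simp) z).hasFDerivAt
  have c0 : ∀ v, fderiv ℝ (linkMap g r) z v 0 = 2 * (inner ℂ z v).re := by
    intro v
    have h2 : HasFDerivAt (fun z : Cn n => ‖z‖ ^ 2 - r ^ 2) _ z :=
      (contDiff_norm_sq.differentiable (by simp) z).hasFDerivAt.sub_const (r ^ 2)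
    rw [← fderiv_norm_sq, ← h1 0 h2]
  have c1 : ∀ v, fderiv ℝ (linkMap g r) z v 1 = (fderiv ℝ g z v).re := by
    exact fun v => h1 1 (Complex.reCLM.hasFDerivAt.comp z hg') v
  have c2 : ∀ v, fderiv ℝ (linkMap g r) z v 2 = (fderiv ℝ g z v).im := by
    exact fun v => h1 2 (Complex.imCLM.hasFDerivAt.comp z hg') v
  intro y
  obtain ⟨v, hv⟩ := hsurj ⟨y 1, y 2⟩
  have hzz : (inner ℂ z z).re = r ^ 2 := by
    rw [inner_self_eq_norm_sq_to_K, hz]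
    simp [← Complex.ofReal_pow]
  refine ⟨v + ((y 0 - 2 * (inner ℂ z v).re) / (2 * r ^ 2)) • z, ?_⟩
  ext i
  fin_cases i
  · simp only [map_add, map_smul, PiLp.add_apply, PiLp.smul_apply, Fin.zero_eta, c0, hzz,
      smul_eq_mul]
    field_simp
    ring
  · simp [c1, hrad, hv]
  · simp [c2, hrad, hv]

lemma smoothOnSet_of_contDiffOn {V W : Type*} [NormedAddCommGroup V] [NormedSpace ℝ V]
    [NormedAddCommGroup W] [NormedSpace ℝ W] {F : V → W} {X U : Set V} (hU : IsOpen U)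
    (hXU : X ⊆ U) (hF : ContDiffOn ℝ ∞ F U) : SmoothOnSet F X :=
  fun _ hx => ⟨U, hU, hXU hx, F, hF, fun _ _ => rfl⟩

/-- Take the tubular neighbourhood of `K_r` in `ℂⁿ` given by `linkMap` and restrict to first
coordinate zero. This is the part in the sphere; the remaining coordinate there is `g`, whence `θ =
η / |η|`. -/
lemma exists_isTubularNbhd (hg : ContDiff ℝ ∞ g) {r : ℝ} (hr : 0 < r)
    (hsub : ∀ x ∈ link g r, Function.Surjective (fderiv ℝ (linkMap g r) x)) :
    ∃ (δ : ℝ) (Φ : Cn n × ℂ → Cn n),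
      IsTubularNbhd (Metric.sphere 0 r) (link g r) (milnorMap g) δ Φ := by
  obtain ⟨δ, hδ, O, hO, hKO, T, π, U, hU, hKU, hT, hπ, hT0, hTx, hy⟩ :=
    exists_trivial_tubular_nhds (contDiff_linkMap hg r)
      (by rw [linkMap_preimage_zero hr]; exact isCompact_link hg.continuous r)
      (fun x hx => hsub x (mem_link.2 ((linkMap_eq_zero hr).1 hx)))
  rw [linkMap_preimage_zero hr] at hKO hKU
  have hK : ∀ x ∈ link g r, linkMap g r x = 0 := fun x hx =>
    (linkMap_eq_zero hr).2 (mem_link.1 hx)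
  have hball : ∀ η ∈ Metric.ball (0 : ℂ) δ, discEmbedding η ∈ Metric.ball 0 δ := by
    intro η hη
    rw [mem_ball_zero_iff] at hη ⊢
    rwa [norm_discEmbedding]
  have hι : ContDiff ℝ ∞ (fun p : Cn n × ℂ => (p.1, discEmbedding p.2)) :=
    contDiff_fst.prodMk (contDiff_discEmbedding.comp contDiff_snd)
  have hTg : ∀ x ∈ link g r, ∀ η ∈ Metric.ball (0 : ℂ) δ,
      ‖T (x, discEmbedding η)‖ = r ∧ g (T (x, discEmbedding η)) = η := fun x hx η hη =>
    (linkMap_eq_discEmbedding hr).1 (hTx x (hK x hx) _ (hball η hη)).2.1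
  refine ⟨δ, fun p => T (p.1, discEmbedding p.2), hδ, ⟨O, hO, hKO, fun y => (π y, g y), ?_, ?_, ?_,
    ?_, ?_, ?_⟩, ?_, ?_⟩
  · refine smoothOnSet_of_contDiffOn (hU.preimage hι.continuous) ?_
      (hT.comp hι.contDiffOn fun p hp => hp)
    rintro ⟨x, η⟩ ⟨hx, hη⟩
    exact hKU ⟨hx, hball η hη⟩
  · exact smoothOnSet_of_contDiffOn hO Set.inter_subset_right (hπ.prodMk hg.contDiffOn)
  · rintro ⟨x, η⟩ ⟨hx, hη⟩
    exact ⟨mem_sphere_zero_iff_norm.2 (hTg x hx η hη).1, (hTx x (hK x hx) _ (hball η hη)).1⟩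
  · rintro y ⟨hyS, hyO⟩
    obtain ⟨h1, h2, -⟩ := hy y hyO
    refine ⟨mem_link.2 ((linkMap_eq_zero hr).1 h2), ?_⟩
    rw [(linkMap_eq_discEmbedding hr).2 ⟨mem_sphere_zero_iff_norm.1 hyS, rfl⟩,
      mem_ball_zero_iff, norm_discEmbedding] at h1
    rwa [mem_ball_zero_iff]
  · rintro ⟨x, η⟩ ⟨hx, hη⟩
    exact Prod.ext (hTx x (hK x hx) _ (hball η hη)).2.2 (hTg x hx η hη).2
  · rintro y ⟨hyS, hyO⟩
    have := (hy y hyO).2.2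
    rwa [(linkMap_eq_discEmbedding hr).2 ⟨mem_sphere_zero_iff_norm.1 hyS, rfl⟩] at this
  · intro x hx
    simp only [discEmbedding_zero]
    exact hT0 x (hK x hx)
  · intro x hx η hη _
    rw [milnorMap, (hTg x hx η hη).2]

/-- The circle action carries the page at `η` to the page at `ζ`, by a rotation through the angle
from `η` to `ζ` divided by `N`. On a half-plane around `η` the principal logarithm makes this angle
smooth. -/
lemma exists_local_trivialization {N : ℝ} (h : IsPolarHomogeneous g N) (r : ℝ) {η : ℂ}
    (hη : ‖η‖ = 1) : ∃ A : Set ℂ, IsOpen A ∧ η ∈ A ∧ ∃ H : Cn n × ℂ → Cn n,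
      DiffeoOn H (page (Metric.sphere 0 r) (link g r) (milnorMap g) η ×ˢ
        (A ∩ Metric.sphere (0 : ℂ) 1)) {z ∈ Metric.sphere 0 r \ link g r | milnorMap g z ∈ A} ∧
      ∀ p ∈ page (Metric.sphere 0 r) (link g r) (milnorMap g) η,
        ∀ ζ ∈ A ∩ Metric.sphere (0 : ℂ) 1, milnorMap g (H (p, ζ)) = ζ := by
  have hN := h.pos.ne'
  set A : Set ℂ := {ζ | 0 < (ζ * conj η).re} with hA
  have hAo : IsOpen A := isOpen_lt continuous_const
    (Complex.continuous_re.comp (continuous_id.mul continuous_const))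
  have hψ : ∀ ζ ∈ A, ContDiffAt ℝ ∞ (relAngle N η) ζ := fun ζ hζ => contDiffAt_relAngle N hζ
  have hmem : ∀ z : Cn n, z ∈ {z ∈ Metric.sphere 0 r \ link g r | milnorMap g z ∈ A} ↔
      ‖z‖ = r ∧ g z ≠ 0 ∧ milnorMap g z ∈ A := by
    intro z
    simp only [link, Set.mem_sdiff, Set.mem_ofPred_eq, mem_sphere_zero_iff_norm]
    tauto
  have hθH : ∀ p ∈ page (Metric.sphere 0 r) (link g r) (milnorMap g) η,
      ∀ ζ ∈ A ∩ Metric.sphere (0 : ℂ) 1,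
        milnorMap g (Complex.exp (relAngle N η ζ * Complex.I) • p) = ζ := by
    rintro p hp ζ ⟨-, hζ⟩
    rw [h.milnorMap_rotate, exp_relAngle hN hη (mem_sphere_zero_iff_norm.1 hζ), (mem_page.1 hp).2.2,
      mul_assoc, conj_mul_of_norm_eq_one hη, mul_one]
  have hcancel : ∀ (t : ℝ) (z : Cn n), Complex.exp (((-t : ℝ) : ℂ) * Complex.I) •
      Complex.exp (t * Complex.I) • z = z := by
    intro t z
    rw [smul_smul, ← Complex.exp_add]
    simp
  refine ⟨A, hAo, ?_, fun p => Complex.exp (relAngle N η p.2 * Complex.I) • p.1,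
    ⟨fun z => (Complex.exp (((-relAngle N η (milnorMap g z) : ℝ) : ℂ) * Complex.I) • z,
      milnorMap g z), ?_, ?_, ?_, ?_, ?_, ?_⟩, hθH⟩
  · change 0 < (η * conj η).re
    rw [mul_conj_of_norm_eq_one hη]
    simp
  · refine smoothOnSet_of_contDiffOn (U := Set.univ ×ˢ A) (isOpen_univ.prod hAo)
      (fun p hp => ⟨trivial, hp.2.1⟩) ?_
    rintro ⟨x, ζ⟩ ⟨-, hζ⟩
    have he : ContDiffAt ℝ ∞ (fun p : Cn n × ℂ => Complex.exp (relAngle N η p.2 * Complex.I))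
        (x, ζ) :=
      Complex.contDiff_exp.contDiffAt.comp (x, ζ) ((Complex.ofRealCLM.contDiff.contDiffAt.comp
      (x, ζ) ((hψ ζ hζ).comp (x, ζ) contDiffAt_snd)).mul contDiffAt_const)
    exact (he.smul contDiffAt_fst).contDiffWithinAt
  · have hθo : ContinuousOn (milnorMap g) {z | g z ≠ 0} := fun z hz =>
      (contDiffAt_milnorMap h.contDiff hz).continuousAt.continuousWithinAt
    refine smoothOnSet_of_contDiffOn (U := {z | g z ≠ 0} ∩ milnorMap g ⁻¹' A)
      (hθo.isOpen_inter_preimage (isOpen_ne_fun h.contDiff.continuous continuous_const) hAo)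
      (fun z hz => ((hmem z).1 hz).2) ?_
    rintro z ⟨hgz, hzA⟩
    have hθ := contDiffAt_milnorMap h.contDiff hgz
    have he : ContDiffAt ℝ ∞ (fun z => Complex.exp (((-relAngle N η (milnorMap g z) : ℝ) : ℂ) *
        Complex.I)) z :=
      Complex.contDiff_exp.contDiffAt.comp z ((Complex.ofRealCLM.contDiff.contDiffAt.comp z
        ((hψ _ hzA).comp z hθ).neg).mul contDiffAt_const)
    exact ((he.smul contDiffAt_id).prodMk hθ).contDiffWithinAt
  · rintro ⟨p, ζ⟩ ⟨hp, hζ⟩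
    obtain ⟨hpr, hgp, -⟩ := mem_page.1 hp
    refine (hmem _).2 ⟨?_, h.rotate_ne_zero _ hgp, ?_⟩
    · rw [norm_exp_smul, hpr]
    · rw [hθH p hp ζ hζ]
      exact hζ.1
  · intro z hz
    obtain ⟨hzr, hgz, hzA⟩ := (hmem z).1 hz
    refine ⟨mem_page.2 ⟨?_, h.rotate_ne_zero _ hgz, ?_⟩, hzA,
      mem_sphere_zero_iff_norm.2 (norm_milnorMap hgz)⟩
    · rw [norm_exp_smul, hzr]
    · rw [h.milnorMap_rotate, exp_neg_relAngle hN hη (norm_milnorMap hgz)]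
  · rintro ⟨p, ζ⟩ ⟨hp, hζ⟩
    simp only [hθH p hp ζ hζ, hcancel]
  · intro z hz
    have := hcancel (-relAngle N η (milnorMap g z)) z
    rwa [neg_neg] at this

theorem isOpenBook_milnorMap {N : ℝ} (h : IsPolarHomogeneous g N) {r : ℝ} (hr : 0 < r)
    (hsurj : ∀ z ∈ link g r, Function.Surjective (fderiv ℝ g z)) :
    IsOpenBook 1 (Metric.sphere 0 r) (link g r) (milnorMap g) where
  manifold := isSubmanifold_sphere hr
  binding_subset := fun z hz => hz.1
  binding := by
    intro x _
    refine ⟨Set.univ, isOpen_univ, trivial, linkMap g r, (contDiff_linkMap h.contDiff r).contDiffOn,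
      ?_, ?_⟩
    · ext z
      rw [Set.inter_univ, mem_link, ← linkMap_eq_zero hr]
      simp
    · rintro y ⟨hy, -⟩
      exact fderiv_linkMap_surjective h.contDiff hr (mem_link.1 hy).1
        (h.radial y (mem_link.1 hy).2) (hsurj y hy)
  smooth := by
    refine ⟨{z | g z ≠ 0}, isOpen_ne_fun h.contDiff.continuous continuous_const, ?_, fun z hz =>
      (contDiffAt_milnorMap h.contDiff hz).contDiffWithinAt⟩
    rintro z ⟨hz, hzl⟩ hg
    exact hzl ⟨hz, hg⟩
  norm_eq_one := by
    rintro z ⟨hz, hzl⟩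
    exact norm_milnorMap fun hg => hzl ⟨hz, hg⟩
  locally_trivial := fun η hη =>
    exists_local_trivialization h r (mem_sphere_zero_iff_norm.1 hη)
  tubular := exists_isTubularNbhd h.contDiff hr fun y hy =>
    fderiv_linkMap_surjective h.contDiff hr (mem_link.1 hy).1
        (h.radial y (mem_link.1 hy).2) (hsurj y hy)

end OpenBook

/-! ### The contact form is carried by the open book -/

section Carried

open scoped Topology

variable {k n : ℕ} {g : Cn n → ℂ}

/-- The real part of the Hermitian product with `z` as a real linear functional. -/
def reInner (z : Cn n) : Cn n →ₗ[ℝ] ℝ :=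
  Complex.reLm ∘ₗ ((innerSL ℂ z : Cn n →ₗ[ℂ] ℂ).restrictScalars ℝ)

lemma reInner_apply (z v : Cn n) : reInner z v = (inner ℂ z v).re := rfl

lemma inner_self_re {r : ℝ} {z : Cn n} (hz : ‖z‖ = r) : (inner ℂ z z).re = r ^ 2 := by
  rw [inner_self_eq_norm_sq_to_K, hz]
  simp [← Complex.ofReal_pow]

lemma inner_self_re_ne_zero {z : Cn n} (hz : z ≠ 0) : reInner z z ≠ 0 := by
  rw [reInner_apply, inner_self_re rfl]
  simpa using hz

/-- The differential of the angle as a linear functional. -/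
def dAngleLinear (θ : Cn n → ℂ) (z : Cn n) : Cn n →ₗ[ℝ] ℝ :=
  Complex.imLm ∘ₗ (LinearMap.mulLeft ℝ (conj (θ z))) ∘ₗ (fderiv ℝ θ z : Cn n →ₗ[ℝ] ℂ)

lemma dAngleLinear_apply (θ : Cn n → ℂ) (z v : Cn n) : dAngleLinear θ z v = dAngle θ z v := rfl

lemma inner_smul_I_left (z v : Cn n) : inner ℂ (Complex.I • z) v = -Complex.I * inner ℂ z v := by
  rw [inner_smul_left]; simp

lemma inner_smul_I_right (z v : Cn n) : inner ℂ z (Complex.I • v) = Complex.I * inner ℂ z v := by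
  rw [inner_smul_right]

lemma inner_real_smul_right (z v : Cn n) (c : ℝ) : inner ℂ z (c • v) = c * inner ℂ z v := by
  rw [show c • v = (c : ℂ) • v from rfl, inner_smul_right]

lemma inner_real_smul_left (z v : Cn n) (c : ℝ) : inner ℂ (c • z) v = c * inner ℂ z v := by
  rw [show c • z = (c : ℂ) • z from rfl, inner_smul_left, Complex.conj_ofReal]

/-- Triangularity: `Re ⟨x, ·⟩` separates `x` from `w`, `Re L` separates `ξ₂` from these, and `Im L`
separates `ξ₁` from all the others. -/
lemma IsSymplecticPair.linearIndependent {L : Cn n →ₗ[ℝ] ℂ} {ξ₁ ξ₂ : Cn n}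
    (h : IsSymplecticPair L ξ₁ ξ₂) {m : ℕ} {x : Cn n} {w : Fin m → Cn n} (hx0 : x ≠ 0)
    (hx : L x = 0) (hw : ∀ i, L (w i) = 0) (hxw : ∀ i, (inner ℂ x (w i)).re = 0)
    (hli : LinearIndependent ℝ w) :
    LinearIndependent ℝ (Fin.cons ξ₁ (Fin.cons ξ₂ (Fin.cons x w : Fin (m + 1) → Cn n) :
      Fin (m + 2) → Cn n) : Fin (m + 3) → Cn n) := by
  refine linearIndependent_cons_of_functional (linearIndependent_cons_of_functional
    (linearIndependent_cons_of_functional hli (reInner x) hxw (inner_self_re_ne_zero hx0))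
    (Complex.reLm ∘ₗ L) (fun i => ?_) h.pos.ne') (Complex.imLm ∘ₗ L) (fun i => ?_) ?_
  · refine Fin.cases ?_ (fun i => ?_) i
    · simp [hx]
    · simp [hw]
  · refine Fin.cases ?_ (fun i => Fin.cases ?_ (fun i => ?_) i) i
    · simp [h.im_right]
    · simp [hx]
    · simp [hw]
  · simp [h.im_left, h.pos.ne']

lemma sphereVolume_ne_zero {r : ℝ} (hr : 0 < r) {z : Cn (k + 2)} (hz : ‖z‖ = r)
    {v : Fin (2 * k + 3) → Cn (k + 2)} (hv : IsFrame (Metric.sphere 0 r) z v) :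
    sphereVolume k z v ≠ 0 := by
  have hz0 : z ≠ 0 := norm_ne_zero_iff.1 (hz ▸ hr.ne')
  exact standardVolume_ne_zero (n := k + 2) _ (linearIndependent_cons_of_functional hv.2 (reInner z)
    (fun i => inner_re_of_mem_tangentVectors_sphere hz (hv.1 i)) (inner_self_re_ne_zero hz0))

/-- The kernel of `ω` on the tangent space of the sphere is the line of `iz`, which is transverse to
the page because `dθ(iz) = N ≠ 0`. -/
lemma IsPolarHomogeneous.isSymplecticOn_page {N : ℝ} (h : IsPolarHomogeneous g N) {r : ℝ}
    (hr : 0 < r) (η : ℂ) : IsSymplecticOn (extDeriv (canonicalForm n))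
      (page (Metric.sphere 0 r) (link g r) (milnorMap g) η) := by
  intro z hz
  refine ⟨fun v _ => extDeriv_extDeriv_canonicalForm z v, fun u hu hΩ => ?_⟩
  obtain ⟨hzr, hgz, rfl⟩ := mem_page.1 hz
  have hzz := inner_self_re hzr
  have hzzi := IsSymplecticPair.inner_self_im z
  have hu1 : (inner ℂ z u).re = 0 := inner_re_of_mem_tangentVectors_sphere hzr
    (tangentVectors_mono (fun y hy => hy.1.1) _ hu)
  have hu2 : dAngle (milnorMap g) z u = 0 := dAngle_of_mem_tangentVectors_page h hgz rfl hu
  have hI := h.dAngle_I_smul hgz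
  -- A tangent vector of the sphere is a tangent vector of the page plus a multiple of `iz`, and
  -- `ω(u, iz) = 4 Re ⟨u,z⟩ = 0`.
  have hΩ' : ∀ v, (inner ℂ z v).re = 0 → (inner ℂ u v).im = 0 := by
    intro v hv
    set s := dAngle (milnorMap g) z v / N with hs
    have hmem := mem_tangentVectors_page h hr hzr hgz (v := v - s • Complex.I • z) (by
      rw [inner_sub_right, inner_real_smul_right, inner_smul_I_right]
      simp [-inner_self_eq_norm_sq_to_K, hv, hzzi]) (by
      rw [← dAngleLinear_apply, map_sub, map_smul, dAngleLinear_apply, dAngleLinear_apply, hI, hs,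
        smul_eq_mul, div_mul_cancel₀ _ h.pos.ne', sub_self])
    have h1 := hΩ _ hmem
    rw [extDeriv_canonicalForm, inner_sub_right, inner_real_smul_right, inner_smul_I_right,
      ← inner_conj_symm u z] at h1
    simp only [Complex.sub_im, Complex.mul_im, Complex.ofReal_re, Complex.ofReal_im, Complex.I_re,
      Complex.I_im, Complex.conj_re, Complex.conj_im, hu1] at h1
    linarith
  set c := (inner ℂ z u).im / r ^ 2 with hc
  set u' := u - c • Complex.I • z with hu'
  have hzu' : inner ℂ z u' = 0 := by
    rw [hu', inner_sub_right, inner_real_smul_right, inner_smul_I_right]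
    apply Complex.ext
    · simp [-inner_self_eq_norm_sq_to_K, hu1, hzzi]
    · simp only [Complex.sub_im, Complex.mul_im, Complex.ofReal_re, Complex.ofReal_im,
        Complex.I_re, Complex.I_im, Complex.mul_re, hzz, hzzi, hc, Complex.zero_im]
      field_simp
      ring
  -- Here `u'` is the part of `u` Hermitian-orthogonal to `z`, so `i u'` is tangent to the sphere,
  -- and `Im ⟨u, i u'⟩ = |u'|²`.
  have h0 := hΩ' (Complex.I • u') (by rw [inner_smul_I_right, hzu']; simp)
  have h1 : u = u' + c • Complex.I • z := by rw [hu']; abel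
  have h2 : (inner ℂ u (Complex.I • u')).im = ‖u'‖ ^ 2 := by
    rw [h1, inner_add_left, inner_real_smul_left, inner_smul_I_left, inner_smul_I_right,
      inner_smul_I_right, hzu', ← inner_self_re (z := u') rfl]
    simp
  rw [h2] at h0
  have hu'0 : u' = 0 := norm_eq_zero.1 (pow_eq_zero_iff two_ne_zero |>.1 h0)
  rw [hu'0, zero_add] at h1
  rw [h1, ← dAngleLinear_apply, map_smul, dAngleLinear_apply, hI, smul_eq_mul] at hu2
  rcases mul_eq_zero.1 hu2 with h3 | h3
  · rw [h1, h3, zero_smul]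
  · exact absurd h3 h.pos.ne'

/-- Modulo `ker dθ`, which contains `z` and all `v i`, the vector `u` equals `(dθ(u) / N) iz`; a
volume of vectors all in `ker dθ` is zero. -/
lemma sphereVolume_cons_page {g : Cn (k + 2) → ℂ} {N : ℝ} (h : IsPolarHomogeneous g N)
    {z : Cn (k + 2)} (hgz : g z ≠ 0) (u : Cn (k + 2)) (v : Fin (2 * k + 2) → Cn (k + 2))
    (hv : ∀ i, dAngle (milnorMap g) z (v i) = 0) :
    sphereVolume k z (Fin.cons u v : Fin (2 * k + 3) → Cn (k + 2)) =
      dAngle (milnorMap g) z u / N *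
        sphereVolume k z (Fin.cons (Complex.I • z) v : Fin (2 * k + 3) → Cn (k + 2)) := by
  set F : Cn (k + 2) [⋀^Fin (2 * k + 2 + 2)]→ₗ[ℝ] ℝ := (realBasis (k + 2)).det with hF
  have hvol : ∀ a : Cn (k + 2), sphereVolume k z (Fin.cons a v : Fin (2 * k + 3) → Cn (k + 2)) =
      F (Fin.cons z (Fin.cons a v : Fin (2 * k + 3) → _)) := fun a => standardVolume_eq_det _
  set s := dAngle (milnorMap g) z u / N with hs
  have hI := h.dAngle_I_smul hgz
  have hker : F (Fin.cons (u - s • Complex.I • z) (Fin.cons z v : Fin (2 * k + 3) → _)) = 0 := by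
    refine (standardVolume_eq_det _).symm.trans (standardVolume_eq_zero_of_functional (n := k + 2) _
      (dAngleLinear (milnorMap g) z) (fun h0 => ?_) fun i => ?_)
    · have := congrArg (fun ℓ => ℓ (Complex.I • z)) h0
      rw [dAngleLinear_apply, hI] at this
      exact h.pos.ne' this
    · refine Fin.cases ?_ (fun i => Fin.cases ?_ (fun i => ?_) i) i
      · rw [Fin.cons_zero, map_sub, map_smul, dAngleLinear_apply, dAngleLinear_apply, hI, hs,
          smul_eq_mul, div_mul_cancel₀ _ h.pos.ne', sub_self]
      · exact h.dAngle_self hgz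
      · exact hv i
  rw [hvol, hvol, alternating_cons_swap F z u, alternating_cons_swap F z (Complex.I • z)]
  conv_lhs => rw [← sub_add_cancel u (s • Complex.I • z), alternating_cons_add, hker, zero_add,
    alternating_cons_smul]
  ring

/-- The derivative of a tubular neighbourhood in a direction of the disc. -/
lemma IsTubularNbhd.exists_hasDerivAt {V : Type*} [NormedAddCommGroup V] [NormedSpace ℝ V]
    {M K : Set V} {θ : V → ℂ} {δ : ℝ} {Φ : V × ℂ → V} (hΦ : IsTubularNbhd M K θ δ Φ)
    (hKM : K ⊆ M) {x : V} (hx : x ∈ K) (η : ℂ) :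
    ∃ q, HasDerivAt (fun t : ℝ => Φ (x, (t : ℂ) * η)) q 0 ∧
      (∀ᶠ t : ℝ in 𝓝 0, Φ (x, (t : ℂ) * η) ∈ M ∧ (t : ℂ) * η ∈ Metric.ball (0 : ℂ) δ) ∧
      ∃ D : V →L[ℝ] ℂ, D q = η ∧ ∀ w ∈ tangentVectors K x, D w = 0 := by
  obtain ⟨O, hO, hKO, G, hΦs, hGs, hmaps, -, hleft, -⟩ := hΦ.diffeo
  have hball : (0 : ℂ) ∈ Metric.ball (0 : ℂ) δ := Metric.mem_ball_self hΦ.pos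
  obtain ⟨U, hU, hxU, F, hF, hFeq⟩ := hΦs (x, 0) ⟨hx, hball⟩
  obtain ⟨U', hU', hxU', F', hF', hFeq'⟩ := hGs x ⟨hKM hx, hKO hx⟩
  have hline : HasDerivAt (fun t : ℝ => (x, (t : ℂ) * η)) ((0 : V), η) 0 := by
    have h1 : HasDerivAt (fun t : ℝ => (t : ℂ) * η) η 0 := by
      simpa using (Complex.ofRealCLM.hasDerivAt (x := (0 : ℝ))).mul_const η
    exact (hasDerivAt_const (0 : ℝ) x).prodMk h1
  have hline0 : (x, ((0 : ℝ) : ℂ) * η) = (x, 0) := by simp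
  have hnear : ∀ᶠ t : ℝ in 𝓝 0, (x, (t : ℂ) * η) ∈ U ∩ (Set.univ ×ˢ Metric.ball (0 : ℂ) δ) := by
    refine hline.continuousAt.eventually_mem ?_
    rw [hline0]
    exact (hU.inter (isOpen_univ.prod Metric.isOpen_ball)).mem_nhds ⟨hxU, trivial, hball⟩
  have hFd : HasFDerivAt F (fderiv ℝ F (x, 0)) (x, ((0 : ℝ) : ℂ) * η) := by
    rw [hline0]
    exact ((hF.contDiffAt (hU.mem_nhds hxU)).differentiableAt (by simp)).hasFDerivAt
  have hc := (hFd.comp_hasDerivAt 0 hline).congr_of_eventuallyEq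
    (f₁ := fun t : ℝ => Φ (x, (t : ℂ) * η))
    (hnear.mono fun t ht => hFeq ⟨⟨hx, ht.2.2⟩, ht.1⟩)
  have hc0 : Φ (x, ((0 : ℝ) : ℂ) * η) = x := by simpa using hΦ.core x hx
  have hFd' : HasFDerivAt F' (fderiv ℝ F' x) x :=
    ((hF'.contDiffAt (hU'.mem_nhds hxU')).differentiableAt (by simp)).hasFDerivAt
  have hmem : ∀ᶠ t : ℝ in 𝓝 0, Φ (x, (t : ℂ) * η) ∈ U' := by
    refine hc.continuousAt.eventually_mem ?_
    rw [hc0]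
    exact hU'.mem_nhds hxU'
  -- `D` is the disc component of the derivative of a smooth extension of the inverse
  -- diffeomorphism. That component is `t η` along the given curve and `0` along the binding.
  refine ⟨_, hc, hnear.mono fun t ht => ⟨(hmaps (x := (x, (t : ℂ) * η)) ⟨hx, ht.2.2⟩).1, ht.2.2⟩,
    (ContinuousLinearMap.snd ℝ V ℂ) ∘L fderiv ℝ F' x, ?_, ?_⟩
  · have h1 := HasFDerivAt.comp_hasDerivAt (0 : ℝ) (f := fun t : ℝ => Φ (x, (t : ℂ) * η))
      (by rw [hc0]; exact hFd') hc
    have h2 := hline.congr_of_eventuallyEq (f₁ := F' ∘ fun t : ℝ => Φ (x, (t : ℂ) * η)) (by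
      filter_upwards [hnear, hmem] with t ht ht'
      have ht2 : (x, (t : ℂ) * η) ∈ K ×ˢ Metric.ball (0 : ℂ) δ := ⟨hx, ht.2.2⟩
      exact (hFeq' ⟨hmaps ht2, ht'⟩).symm.trans (hleft ht2))
    exact congrArg Prod.snd (h1.unique h2)
  · intro w hw
    obtain ⟨γ, hγ, hγ0, hγK⟩ := exists_hasDerivAt_of_mem_tangentVectors hw
    have h1 := HasFDerivAt.comp_hasDerivAt (0 : ℝ) (by rw [hγ0]; exact hFd') hγ
    have hγU : ∀ᶠ t : ℝ in 𝓝 0, γ t ∈ U' := by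
      refine hγ.continuousAt.eventually_mem ?_
      rw [hγ0]
      exact hU'.mem_nhds hxU'
    have h2 := (hγ.prodMk (hasDerivAt_const (0 : ℝ) (0 : ℂ))).congr_of_eventuallyEq
      (f₁ := F' ∘ γ) (by
      filter_upwards [hγK, hγU] with t ht ht'
      have h3 := hleft (show (γ t, (0 : ℂ)) ∈ K ×ˢ Metric.ball (0 : ℂ) δ from ⟨ht, hball⟩)
      rw [hΦ.core _ ht] at h3
      exact (hFeq' ⟨⟨hKM ht, hKO ht⟩, ht'⟩).symm.trans h3)
    exact congrArg Prod.snd (h1.unique h2)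

/-- A function of a real variable with the sign of its argument has a non-negative derivative. -/
lemma deriv_nonneg_of_sign {ρ : ℝ → ℝ} {m : ℝ} (hρ : HasDerivAt ρ m 0) (h0 : ρ 0 = 0)
    (h : ∀ᶠ t in 𝓝[≠] (0 : ℝ), 0 ≤ t⁻¹ * ρ t) : 0 ≤ m := by
  refine ge_of_tendsto (hasDerivAt_iff_tendsto_slope.1 hρ) (h.mono fun t ht => ?_)
  simpa [slope, h0] using ht

/-- Along `t ↦ Φ (x, t η)` the angle is `sign(t) η`, so `g conj η` is real with the sign of `t`, and
its derivative at `0` is real and non-negative. It is not zero, since otherwise the velocity would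
be a direction along the link independent of its full tangent frame. -/
lemma IsTubularNbhd.exists_deriv_eq {g : Cn (k + 2) → ℂ} (hg : ContDiff ℝ ∞ g) {r : ℝ} (hr : 0 < r)
    {δ : ℝ} {Φ : Cn (k + 2) × ℂ → Cn (k + 2)}
    (hΦ : IsTubularNbhd (Metric.sphere 0 r) (link g r) (milnorMap g) δ Φ) {x : Cn (k + 2)}
    (hx : x ∈ link g r) (hrad : fderiv ℝ g x x = 0) {ξ₁ ξ₂ : Cn (k + 2)}
    (hξ : IsSymplecticPair (fderiv ℝ g x : Cn (k + 2) →ₗ[ℝ] ℂ) ξ₁ ξ₂) {η : ℂ} (hη : ‖η‖ = 1)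
    {w : Fin (2 * k + 1) → Cn (k + 2)} (hw : IsFrame (link g r) x w) :
    ∃ s : ℝ, 0 < s ∧
      fderiv ℝ g x (deriv (fun t : ℝ => Φ (x, (t : ℂ) * η)) 0) = s * η := by
  have hKM : link g r ⊆ Metric.sphere 0 r := fun y hy => hy.1
  obtain ⟨hxr, hgx⟩ := mem_link.1 hx
  have hx0 : x ≠ 0 := norm_ne_zero_iff.1 (hxr ▸ hr.ne')
  obtain ⟨q, hq, hmem, D, hDq, hDw⟩ := hΦ.exists_hasDerivAt hKM hx η
  rw [hq.deriv]
  set c : ℝ → Cn (k + 2) := fun t => Φ (x, (t : ℂ) * η) with hc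
  have hc0 : c 0 = x := by simpa [hc] using hΦ.core x hx
  have hgd : HasFDerivAt g (fderiv ℝ g x) (c 0) := by
    rw [hc0]; exact (hg.differentiable (by simp) x).hasFDerivAt
  have hρ : HasDerivAt (fun t => g (c t) * conj η) (fderiv ℝ g x q * conj η) 0 :=
    (hgd.comp_hasDerivAt 0 hq).mul_const (conj η)
  have hη0 : η ≠ 0 := by rintro rfl; simp at hη
  have hval : ∀ᶠ t : ℝ in 𝓝[≠] 0, g (c t) * conj η = ((‖g (c t)‖ * (t / |t|) : ℝ) : ℂ) := by
    filter_upwards [hmem.filter_mono nhdsWithin_le_nhds, self_mem_nhdsWithin] with t ht ht0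
    have ht0' : (t : ℂ) ≠ 0 := by exact_mod_cast ht0
    have h1 := hΦ.angle x hx _ ht.2 (mul_ne_zero ht0' hη0)
    rw [norm_mul, hη, mul_one, Complex.norm_real, Real.norm_eq_abs, milnorMap] at h1
    -- If `g` vanished, division by zero would give `milnorMap` the value `0`, whereas the
    -- prescribed angle is non-zero.
    have hgne : g (c t) ≠ 0 := by
      intro h0
      have h2 : (t : ℂ) * η / (|t| : ℝ) ≠ 0 :=
        div_ne_zero (mul_ne_zero ht0' hη0) (by simpa using ht0)
      refine h2 (h1.symm.trans ?_)
      change g (c t) / _ = 0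
      rw [h0, zero_div]
    have h3 : g (c t) = (‖g (c t)‖ : ℂ) * ((t : ℂ) * η / (|t| : ℝ)) := by
      rw [← h1, mul_div_cancel₀]
      simpa using hgne
    conv_lhs => rw [h3, mul_assoc, div_mul_eq_mul_div, mul_assoc (t : ℂ),
      mul_conj_of_norm_eq_one hη, mul_one]
    push_cast
    rfl
  have him : (fderiv ℝ g x q * conj η).im = 0 := by
    have h1 := Complex.imCLM.hasFDerivAt.comp_hasDerivAt 0 hρ
    refine h1.unique ((hasDerivAt_const (0 : ℝ) (0 : ℝ)).congr_of_eventuallyEq ?_)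
    filter_upwards [eventually_nhdsWithin_iff.1 hval] with t ht
    rcases eq_or_ne t 0 with rfl | ht0
    · simp [hc0, hgx]
    · simp only [Function.comp_apply, ht ht0, Complex.imCLM_apply, Complex.ofReal_im]
  have hre : 0 ≤ (fderiv ℝ g x q * conj η).re := by
    have h1 := Complex.reCLM.hasFDerivAt.comp_hasDerivAt 0 hρ
    refine deriv_nonneg_of_sign h1 (by simp [hc0, hgx]) (hval.mono fun t ht => ?_)
    simp only [Function.comp_apply, ht, Complex.reCLM_apply, Complex.ofReal_re]
    rw [show t⁻¹ * (‖g (c t)‖ * (t / |t|)) = ‖g (c t)‖ * (t⁻¹ * t) / |t| by ring]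
    have : 0 ≤ t⁻¹ * t := by
      rcases eq_or_ne t 0 with rfl | ht0
      · simp
      · rw [inv_mul_cancel₀ ht0]; exact zero_le_one
    positivity
  have hLq : fderiv ℝ g x q = ((fderiv ℝ g x q * conj η).re : ℂ) * η := by
    have h1 : (((fderiv ℝ g x q * conj η).re : ℝ) : ℂ) = fderiv ℝ g x q * conj η :=
      Complex.ext rfl (by simp [him])
    rw [h1, mul_assoc, conj_mul_of_norm_eq_one hη, mul_one]
  refine ⟨_, lt_of_le_of_ne hre fun h0 => ?_, hLq⟩
  rw [← h0] at hLq
  have hq0 : fderiv ℝ g x q = 0 := by simpa using hLq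
  have hqx : (inner ℂ x q).re = 0 := by
    have h1 : HasFDerivAt (fun z : Cn (k + 2) => ‖z‖ ^ 2) (fderiv ℝ (fun z => ‖z‖ ^ 2) x) (c 0) := by
      rw [hc0]; exact (contDiff_norm_sq.differentiable (by simp) x).hasFDerivAt
    have h2 := (h1.comp_hasDerivAt 0 hq).unique
      ((hasDerivAt_const (0 : ℝ) (r ^ 2)).congr_of_eventuallyEq (hmem.mono fun t ht => by
        rw [Function.comp_apply, mem_sphere_zero_iff_norm.1 ht.1]))
    rw [fderiv_norm_sq] at h2
    linarith
  have hli : LinearIndependent ℝ (Fin.cons q w : Fin (2 * k + 2) → Cn (k + 2)) := by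
    refine linearIndependent_cons_of_functional hw.2
      (Complex.reLm ∘ₗ LinearMap.mulLeft ℝ (conj η) ∘ₗ (D : Cn (k + 2) →ₗ[ℝ] ℂ)) (fun i => ?_) ?_
    · simp [hDw _ (hw.1 i)]
    · change (conj η * D q).re ≠ 0
      rw [hDq, conj_mul_of_norm_eq_one hη]
      simp
  have hLw : ∀ i, fderiv ℝ g x (w i) = 0 := fun i =>
    fderiv_eq_zero_of_mem_tangentVectors (hg.differentiable (by simp) x)
      (fun y hy => (mem_link.1 hy).2.trans hgx.symm) (hw.1 i)
  have hxw : ∀ i, (inner ℂ x (w i)).re = 0 := fun i =>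
    inner_re_of_mem_tangentVectors_sphere hxr (tangentVectors_mono hKM _ (hw.1 i))
  -- The vectors `ξ₁, ξ₂, x, q, w` would be `2k + 5` independent vectors in real dimension `2k + 4`.
  have := (hξ.linearIndependent hx0 hrad (Fin.cases hq0 hLw) (Fin.cases hqx hxw)
    hli).fintype_card_le_finrank
  rw [finrank_Cn, Fintype.card_fin] at this
  omega

theorem isCarriedBy_milnorMap {g : Cn (k + 2) → ℂ} {N : ℝ} (h : IsPolarHomogeneous g N) {r : ℝ}
    (hr : 0 < r) (hξ : ∀ z ∈ link g r, ∃ ξ₁ ξ₂,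
      IsSymplecticPair (fderiv ℝ g z : Cn (k + 2) →ₗ[ℝ] ℂ) ξ₁ ξ₂) :
    IsCarriedBy k (Metric.sphere 0 r) (sphereVolume k) (link g r) (milnorMap g)
      (canonicalForm (k + 2)) := by
  obtain ⟨C, hC, hvol⟩ := exists_contactVolume_eq_sphereVolume k
  have hKM : link g r ⊆ Metric.sphere 0 r := fun y hy => hy.1
  have hlink : ∀ x ∈ link g r, ∀ w : Fin (2 * k + 1) → Cn (k + 2), IsFrame (link g r) x w →
      x ≠ 0 ∧ fderiv ℝ g x x = 0 ∧ (∀ i, fderiv ℝ g x (w i) = 0) ∧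
        ∀ i, (inner ℂ x (w i)).re = 0 := by
    intro x hx w hw
    obtain ⟨hxr, hgx⟩ := mem_link.1 hx
    exact ⟨norm_ne_zero_iff.1 (hxr ▸ hr.ne'), h.radial x hgx, fun i =>
      fderiv_eq_zero_of_mem_tangentVectors (h.contDiff.differentiable (by simp) x)
        (fun y hy => (mem_link.1 hy).2.trans hgx.symm) (hw.1 i), fun i =>
      inner_re_of_mem_tangentVectors_sphere hxr (tangentVectors_mono hKM _ (hw.1 i))⟩
  refine ⟨?_, ?_, ?_, fun η _ => h.isSymplecticOn_page hr η, ?_, ?_⟩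
  · intro z hz v hv
    rw [hvol]
    exact mul_ne_zero hC.ne' (sphereVolume_ne_zero hr (mem_sphere_zero_iff_norm.1 hz) hv)
  · intro z _ v _
    rw [hvol]
    exact mul_pos_iff_of_pos_left hC
  · intro x hx w hw
    obtain ⟨hx0, hxx, hLw, hxw⟩ := hlink x hx w hw
    obtain ⟨ξ₁, ξ₂, hp⟩ := hξ x hx
    obtain ⟨C', hC', hvol'⟩ := exists_contactVolume_eq_standardVolume hp
    rw [hvol' x w hxx hLw]
    exact mul_ne_zero hC'.ne'
      (standardVolume_ne_zero (n := k + 2) _ (hp.linearIndependent hx0 hxx hLw hxw hw.2))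
  · intro η _ z hz u _ hu v hv
    obtain ⟨hzr, hgz, rfl⟩ := mem_page.1 hz
    have hv1 : ∀ i, dAngle (milnorMap g) z (v i) = 0 := fun i =>
      dAngle_of_mem_tangentVectors_page h hgz rfl (hv.1 i)
    have hv2 : ∀ i, (inner ℂ z (v i)).re = 0 := fun i => inner_re_of_mem_tangentVectors_sphere hzr
      (tangentVectors_mono (fun y hy => hy.1.1) _ (hv.1 i))
    -- Evaluate `α ∧ ω^(k+1)` on `(iz, v)` in two ways: as a positive multiple of `ω^(k+1)(v)` and
    -- as a positive multiple of the sphere volume. Then replace `iz` by `u`, at the cost of the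
    -- positive factor `dθ(u) / N`.
    have h1 := contactVolume_cons_I_smul (m := k + 1) z v hv2
    have h2 := hvol z (Fin.cons (Complex.I • z) v : Fin (2 * k + 3) → Cn (k + 2))
    have h3 : C * sphereVolume k z (Fin.cons (Complex.I • z) v : Fin (2 * k + 3) → Cn (k + 2)) =
        2 * ‖z‖ ^ 2 * twoFormPow (extDeriv (canonicalForm (k + 2)) z) (k + 1) v := h2.symm.trans h1
    have h4 : 0 < dAngle (milnorMap g) z u / N := div_pos hu h.pos
    have h5 : 0 < 2 * ‖z‖ ^ 2 := by rw [hzr]; positivity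
    rw [sphereVolume_cons_page h hgz u v hv1, mul_pos_iff_of_pos_left h4]
    refine Iff.trans ?_ (mul_pos_iff_of_pos_left hC)
    rw [h3, mul_pos_iff_of_pos_left h5]
  · intro δ Φ hΦ η hη x hx w hw
    have hη1 : ‖η‖ = 1 := mem_sphere_zero_iff_norm.1 hη
    obtain ⟨hx0, hxx, hLw, hxw⟩ := hlink x hx w hw
    obtain ⟨ξ₁, ξ₂, hp⟩ := hξ x hx
    obtain ⟨C', hC', hvol'⟩ := exists_contactVolume_eq_standardVolume hp
    obtain ⟨s, hs, hLs⟩ := hΦ.exists_deriv_eq h.contDiff hr hx hxx hp hη1 hw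
    obtain ⟨s', hs', hLs'⟩ := hΦ.exists_deriv_eq h.contDiff hr hx hxx hp (η := Complex.I * η)
      (by rw [norm_mul, Complex.norm_I, one_mul, hη1]) hw
    set q := deriv (fun t : ℝ => Φ (x, (t : ℂ) * η)) 0
    set p := deriv (fun t : ℝ => Φ (x, (t : ℂ) * (Complex.I * η))) 0
    have h1 := standardVolume_cons_cons hp q p (Fin.cons x w : Fin (2 * k + 2) → Cn (k + 2))
      (Fin.cases hxx hLw)
    -- `dg` maps `q` to `s η` and `p` to `s' i η`, a positive pair in `ℂ`.
    have h2 : (conj (fderiv ℝ g x q) * fderiv ℝ g x p).im = s * s' := by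
      rw [hLs, hLs', map_mul, Complex.conj_ofReal,
        show (s : ℂ) * conj η * (s' * (Complex.I * η)) =
          ((s * s' : ℝ) : ℂ) * Complex.I * (conj η * η) by push_cast; ring,
        conj_mul_of_norm_eq_one hη1]
      simp
    -- Exchanging `x` with `-q` costs one sign, and the outward normal `-q` supplies another.
    have h3 : sphereVolume k x (Fin.cons p (Fin.cons (-q) w : Fin (2 * k + 2) → Cn (k + 2)) :
        Fin (2 * k + 3) → Cn (k + 2)) = standardVolume (n := k + 2)
        (Fin.cons q (Fin.cons p (Fin.cons x w : Fin (2 * k + 2) → Cn (k + 2)) :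
          Fin (2 * k + 3) → Cn (k + 2)) : Fin (2 * k + 4) → Cn (k + 2)) := by
      set F : Cn (k + 2) [⋀^Fin (2 * k + 1 + 3)]→ₗ[ℝ] ℝ := (realBasis (k + 2)).det
      have e1 := alternating_cons_swap_zero_two F x p (-q) w
      have e2 := alternating_cons_smul F (-1) q
        (Fin.cons p (Fin.cons x w : Fin (2 * k + 2) → Cn (k + 2)) : Fin (2 * k + 3) → Cn (k + 2))
      rw [neg_one_smul] at e2
      refine (standardVolume_eq_det (n := k + 2) _).trans (e1.trans ?_)
      refine Eq.trans ?_ (standardVolume_eq_det (n := k + 2) _).symm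
      change _ = F _
      rw [e2]
      ring
    have h4 : 0 < s * s' / ((fderiv ℝ g x : Cn (k + 2) →ₗ[ℝ] ℂ) ξ₂).re ^ 2 := by
      have := hp.pos
      positivity
    rw [hvol' x w hxx hLw, mul_pos_iff_of_pos_left hC', h3, h1]
    change _ ↔ 0 < (conj (fderiv ℝ g x q) * fderiv ℝ g x p).im / _ * _
    rw [h2, mul_pos_iff_of_pos_left h4]

end Carried

/-! ### The Reeb vector field -/

section Reeb

variable {n : ℕ}

/-- For uniqueness, the difference `u` of a Reeb vector and the candidate is Hermitian-orthogonal to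
`z`, so `i u` is tangent to the sphere. Testing `ω(u, ·) = 0` on it gives `|u|² = 0`. -/
lemma isReebVector_iff {r : ℝ} (hr : 0 < r) {z : Cn n} (hz : ‖z‖ = r) (R : Cn n) :
    IsReebVector (canonicalForm n) (Metric.sphere 0 r) z R ↔
      R = (1 / (2 * r ^ 2)) • Complex.I • z := by
  have hzz := inner_self_re hz
  have hzzi := IsSymplecticPair.inner_self_im z
  have hΩ0 : ∀ v, (inner ℂ z v).re = 0 →
      (inner ℂ ((1 / (2 * r ^ 2)) • Complex.I • z) v).im = 0 := by
    intro v hv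
    rw [inner_real_smul_left, inner_smul_I_left]
    simp only [Complex.mul_im, Complex.mul_re, Complex.neg_re, Complex.neg_im, Complex.I_re,
      Complex.I_im, Complex.ofReal_re, Complex.ofReal_im, hv]
    ring
  constructor
  · rintro ⟨hR, hα, hΩ⟩
    rw [mem_tangentVectors_sphere hr hz] at hR
    rw [canonicalForm_apply] at hα
    rw [← sub_eq_zero]
    set u := R - (1 / (2 * r ^ 2)) • Complex.I • z with hu
    have hzu : inner ℂ z u = 0 := by
      rw [hu, inner_sub_right, inner_real_smul_right, inner_smul_I_right]
      apply Complex.ext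
      · simp only [Complex.sub_re, Complex.mul_re, Complex.mul_im, Complex.ofReal_re, Complex.ofReal_im,
          Complex.I_re, Complex.I_im, Complex.zero_re, hzzi, hR]
        ring
      · simp only [Complex.sub_im, Complex.mul_im, Complex.ofReal_re, Complex.ofReal_im,
          Complex.I_re, Complex.I_im, Complex.mul_re, hzz, hzzi, Complex.zero_im]
        have h5 : 1 / (2 * r ^ 2) * r ^ 2 = 1 / 2 := by field_simp
        linear_combination (1 / 2) * hα - h5
    have hIu : (inner ℂ z (Complex.I • u)).re = 0 := by rw [inner_smul_I_right, hzu]; simp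
    have h1 := hΩ (Complex.I • u) ((mem_tangentVectors_sphere hr hz).2 hIu)
    rw [extDeriv_canonicalForm] at h1
    have h2 : (inner ℂ u (Complex.I • u)).im = 0 := by
      conv_lhs => rw [show inner ℂ u (Complex.I • u) = inner ℂ R (Complex.I • u) -
        inner ℂ ((1 / (2 * r ^ 2)) • Complex.I • z) (Complex.I • u) by rw [hu, inner_sub_left]]
      rw [Complex.sub_im, hΩ0 _ hIu]
      linarith
    rw [inner_smul_I_right, Complex.I_mul_im, inner_self_re rfl] at h2
    exact norm_eq_zero.1 (pow_eq_zero_iff two_ne_zero |>.1 h2)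
  · rintro rfl
    refine ⟨(mem_tangentVectors_sphere hr hz).2 ?_, ?_, fun v hv => ?_⟩
    · rw [inner_real_smul_right, inner_smul_I_right]
      simp only [Complex.mul_re, Complex.mul_im, Complex.ofReal_re, Complex.ofReal_im,
        Complex.I_re, Complex.I_im, hzzi]
      ring
    · rw [canonicalForm_apply, inner_real_smul_right, inner_smul_I_right]
      simp only [Complex.mul_im, Complex.ofReal_re, Complex.ofReal_im, Complex.I_re, Complex.I_im,
        Complex.mul_re, hzz, hzzi]
      field_simp
      ring
    · rw [extDeriv_canonicalForm, hΩ0 v ((mem_tangentVectors_sphere hr hz).1 hv), mul_zero]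

end Reeb

end MixedLink

end

/-! ### The main theorem, in complex dimension `n = k + 2`. -/

theorem mainTheorem3 (k a b d : ℕ) (hab : b < a) (hd : 0 < d)
    (f : MvPolynomial (Fin (k + 2)) ℂ) (hf : f.IsHomogeneous d)
    (hconv : MixedLink.IsConvenient f) (hnd : MixedLink.IsNonDegenerate f)
    (g : MixedLink.Cn (k + 2) → ℂ) (hg : g = MixedLink.mixedPullback a b f)
    (r : ℝ) (hr : 0 < r) :
    -- the Milnor map defines an open book on the sphere `S_r` with binding the link `K_r`
    MixedLink.IsOpenBook 1 (Metric.sphere 0 r) (MixedLink.link g r) (MixedLink.milnorMap g) ∧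
    -- the canonical contact form is adapted to it
    MixedLink.IsCarriedBy k (Metric.sphere 0 r) (MixedLink.sphereVolume k) (MixedLink.link g r)
      (MixedLink.milnorMap g) (MixedLink.canonicalForm (k + 2)) ∧
    -- the Reeb vector field `R` exists and is unique
    (∀ z ∈ Metric.sphere (0 : MixedLink.Cn (k + 2)) r, ∃! R : MixedLink.Cn (k + 2),
      MixedLink.IsReebVector (MixedLink.canonicalForm (k + 2)) (Metric.sphere 0 r) z R) ∧
    -- and `dθ(R) = d (a - b) / (2 r²) > 0` off the link
    (∀ z ∈ Metric.sphere (0 : MixedLink.Cn (k + 2)) r \ MixedLink.link g r,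
      ∀ R : MixedLink.Cn (k + 2),
      MixedLink.IsReebVector (MixedLink.canonicalForm (k + 2)) (Metric.sphere 0 r) z R →
        MixedLink.dAngle (MixedLink.milnorMap g) z R = d * ((a : ℝ) - b) / (2 * r ^ 2) ∧
        0 < MixedLink.dAngle (MixedLink.milnorMap g) z R) := by
  have h : MixedLink.IsPolarHomogeneous g (d * ((a : ℝ) - b)) := by
    subst hg
    exact MixedLink.isPolarHomogeneous_mixedPullback hab hd hf
  have hξ : ∀ z ∈ MixedLink.link g r, ∃ ξ₁ ξ₂, MixedLink.IsSymplecticPair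
      (fderiv ℝ g z : MixedLink.Cn (k + 2) →ₗ[ℝ] ℂ) ξ₁ ξ₂ := by
    subst hg
    intro z hz
    obtain ⟨hzr, hgz⟩ := MixedLink.mem_link.1 hz
    exact MixedLink.exists_isSymplecticPair_mixedPullback hab hf hconv hnd
      (norm_ne_zero_iff.1 (hzr ▸ hr.ne')) hgz
  refine ⟨MixedLink.isOpenBook_milnorMap h hr fun z hz => ?_,
    MixedLink.isCarriedBy_milnorMap h hr hξ, fun z hz => ?_, fun z hz R hR => ?_⟩
  · obtain ⟨ξ₁, ξ₂, hp⟩ := hξ z hz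
    exact hp.surjective
  · have hzr := mem_sphere_zero_iff_norm.1 hz
    exact ⟨_, (MixedLink.isReebVector_iff hr hzr _).2 rfl, fun R hR =>
      (MixedLink.isReebVector_iff hr hzr R).1 hR⟩
  · have hzr := mem_sphere_zero_iff_norm.1 hz.1
    have hgz : g z ≠ 0 := fun h0 => hz.2 (MixedLink.mem_link.2 ⟨hzr, h0⟩)
    have hval : MixedLink.dAngle (MixedLink.milnorMap g) z R =
        d * ((a : ℝ) - b) / (2 * r ^ 2) := by
      rw [(MixedLink.isReebVector_iff hr hzr R).1 hR, ← MixedLink.dAngleLinear_apply, map_smul,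
        MixedLink.dAngleLinear_apply, h.dAngle_I_smul hgz, smul_eq_mul]
      ring
    refine ⟨hval, ?_⟩
    rw [hval]
    have := h.pos
    positivity
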